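/- **Setting.** Let $a>0$, and let $\mathbb M_2=\mathbb R^2$ be the Minkowski plane with light-cone coordinates $x=(\tau,\xi)$ and $x^2=4\tau\xi$. Configurations are $\varphi\in C^\infty(\mathbb M_2,\mathbb R)$, and $\hbar$ is a formal variable. Let $L_{\rm int}(x)=\cos(a\varphi(x))$. Let $\varphi'=\sum_{\nu\ge0}A_\nu\alpha^\nu$, $A_0=\varphi$, be the formal power series solution of the Bäcklund equation $\tfrac12(\varphi'+\varphi)_\xi=\tfrac1\alpha\sin\big(\tfrac a2(\varphi'-\varphi)\big)$, write $\hat B_{\pm\alpha}\varphi=\sum_\nu A_\nu(\pm\alpha)^\nu$, and let $s_2^N(x)$ ($N\ge 0$) be the value at $x$ of the coefficient of $\alpha^{2N}$ in $$\frac1{\alpha^2}\Big\{2-\cos\big[\tfrac a2(\varphi-\hat B_{-\alpha}\varphi)\big]-\cos\big[\tfrac a2(\varphi-\hat B_{\alpha}\varphi)\big]\Big\}.$$ Let $\Delta^F(x)=-\frac1{4\pi}\log\big(\mu^2(x^2+i0)\big)$ be the massless Feynman propagator, with an arbitrary mass scale $\mu>0$. Put $F\star_F G=\sum_{n\ge0}\frac{\hbar^n}{n!}\big\langle\frac{\delta^nF}{\delta\varphi^n},(\Delta^F)^{\otimes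 n}\frac{\delta^nG}{\delta\varphi^n}\big\rangle$, $T_0=1$ and $T_l(F_1\otimes\dots\otimes F_l)=F_1\star_F\cdots\star_FF_l$. The products of Feynman propagators and of their derivatives that occur are taken as distributions on the set $\check{\mathbb M}_2^{\,n}$ of $n$-tuples of pairwise distinct points; there they are the limits, as $\varepsilon\to0^+$, of the products formed with $\Delta^F_\varepsilon(x)=-\frac1{4\pi}\log\big(\mu^2(x^2+i\varepsilon)\big)$. **Proposition.** For all $l,N\ge0$ and every configuration $\varphi$, the unrenormalized time-ordered product $T_{l+1}\big(L_{\rm int}(x_1)\otimes\dots\otimes L_{\rm int}(x_l)\otimes s_2^N(x_{l+1})\big)$ and all the terms on the right-hand side below are well defined as formal power series in $\hbar$ with coefficients in the distributions in $(x_1,\dots,x_{l+1})\in\check{\mathbb M}_2^{\,l+1}$, and $$T_{l+1}\big(L_{\rm int}^{\otimes l}\otimes s_2^N\big)=\sum_{j=0}^{2(N+1)}\hbar^j\sum_{\substack{j_1,\dots,j_l\ge0\\ j_1+\dots+j_l=j}}\frac1{j_1!\cdots j_l!}\,(\Delta^F)^j\,T_l\Big(\frac{\delta^{j_1}L_{\rm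 int}}{\delta\varphi^{j_1}}\otimes\dots\otimes\frac{\delta^{j_l}L_{\rm int}}{\delta\varphi^{j_l}}\Big)\frac{\delta^js_2^N}{\delta\varphi^j}.$$ Here $(\Delta^F)^j\,T_l(\dots)\,\frac{\delta^j s_2^N}{\delta\varphi^j}$ denotes the pairing with $j$ propagators, each joining one of the $j=j_1+\dots+j_l$ functional-derivative arguments of the factors $L_{\rm int}$ to one of the $j$ functional-derivative arguments of $s_2^N$. -/

import Mathlib

open MeasureTheory Filter Topology
open scoped ContDiff Distributions

namespace SineGordon

noncomputable section

/-! ### Minkowski plane, configurations, observables -/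

/-- The two-dimensional Minkowski space in light-cone coordinates `x = (τ, ξ)`, where
`τ = (x¹ + t) / 2` and `ξ = (x¹ - t) / 2`. -/
abbrev Mink : Type := ℝ × ℝ

/-- The Minkowski square `-t² + (x¹)² = 4 τ ξ`. -/
def minkSq (x : Mink) : ℝ := 4 * x.1 * x.2

/-- The real vector space of smooth real functions on the Minkowski plane. -/
def smoothFunctions : Submodule ℝ (Mink → ℝ) where
  carrier := {φ | ContDiff ℝ ∞ φ}
  add_mem' := by
    intro f g hf hg
    have hf' : ContDiff ℝ ∞ f := hf
    have hg' : ContDiff ℝ ∞ g := hg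
    exact hf'.add hg'
  zero_mem' := (contDiff_const : ContDiff ℝ ∞ (fun _ : Mink => (0 : ℝ)))
  smul_mem' := by
    intro c f hf
    have hf' : ContDiff ℝ ∞ f := hf
    exact hf'.const_smul c

/-- Configurations `φ ∈ C^∞(𝕄₂)`. -/
abbrev Conf : Type := smoothFunctions

/-- Observables: complex functionals of the configuration. With `PowerSeries Obs` we denote formal
power series in `ħ` with coefficients in observables. -/
abbrev Obs : Type := Conf → ℂ

/-- First functional derivative `⟨δF/δφ, h⟩` in the direction `h`. -/
def dirDeriv (h : Conf) (F : Obs) : Obs :=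
  fun φ => deriv (fun t : ℝ => F (φ + t • h)) 0

/-- The `n`-th functional derivative `⟨δⁿF/δφⁿ, h₁ ⊗ ⋯ ⊗ hₙ⟩`. -/
def funcDeriv : (n : ℕ) → (Fin n → Conf) → Obs → Obs
  | 0, _, F => F
  | n + 1, h, F => dirDeriv (h 0) (funcDeriv n (fun i => h i.succ) F)

/-! ### Pairings with smooth propagators, star products, time-ordered products -/

/-- A smooth bump function of integral one, supported in the ball of radius `1 / (k + 1)` about
the origin. -/
def bump (k : ℕ) : ContDiffBump (0 : Mink) where
  rIn := 1 / (2 * (k + 1))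
  rOut := 1 / (k + 1)
  rIn_pos := by positivity
  rIn_lt_rOut := by
    have h : (0 : ℝ) < k + 1 := by positivity
    apply one_div_lt_one_div_of_lt h
    linarith

/-- The approximation `y ↦ ρ_k (y - u)` of the Dirac delta at the point `u`. -/
def deltaApprox (k : ℕ) (u : Mink) : Conf :=
  ⟨fun y => (bump k).normed volume (y - u),
    ((bump k).contDiff_normed (n := ⊤)).comp (contDiff_id.sub contDiff_const)⟩

/-- The pairing `⟨A, H^{⊗n} B⟩ = ∫∫ A(u₁,…,uₙ) H(u₁ - v₁) ⋯ H(uₙ - vₙ) B(v₁,…,vₙ) du dv` of two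
compactly supported distributions `A`, `B` on `𝕄₂ⁿ`, given by their values on tensor products
`h₁ ⊗ ⋯ ⊗ hₙ`, with a product of smooth translation-invariant kernels. The integral kernel
`A(u₁,…,uₙ)` is the weak limit of the smooth functions `A(δ_{u₁} ⊗ ⋯ ⊗ δ_{uₙ})`, the deltas being
replaced by approximations. -/
def pairing (n : ℕ) (H : Mink → ℂ) (A B : (Fin n → Conf) → ℂ) : ℂ :=
  limUnder atTop (fun k : ℕ => ∫ u : Fin n → Mink, ∫ v : Fin n → Mink,
    A (fun i => deltaApprox k (u i)) * (∏ i, H (u i - v i)) * B (fun i => deltaApprox k (v i)))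

/-- The product `F ⋆_H G = ∑ₙ ħⁿ/n! ⟨δⁿF/δφⁿ, H^{⊗n} δⁿG/δφⁿ⟩` of formal power series in `ħ`. -/
def star (H : Mink → ℂ) (F G : PowerSeries Obs) : PowerSeries Obs :=
  PowerSeries.mk fun p => fun φ =>
    ∑ n ∈ Finset.range (p + 1), ∑ bc ∈ Finset.HasAntidiagonal.antidiagonal (p - n),
      ((n.factorial : ℂ))⁻¹ * pairing n H
        (fun h => funcDeriv n h (PowerSeries.coeff bc.1 F) φ)
        (fun h => funcDeriv n h (PowerSeries.coeff bc.2 G) φ)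

/-- `T_l(F₁ ⊗ ⋯ ⊗ F_l) = F₁ ⋆_H ⋯ ⋆_H F_l`, with `T_0 = 1`. -/
def timeOrdered (H : Mink → ℂ) : (l : ℕ) → (Fin l → PowerSeries Obs) → PowerSeries Obs
  | 0, _ => 1
  | l + 1, F => star H (timeOrdered H l (fun i => F i.castSucc)) (F (Fin.last l))

/-- The massless Feynman propagator `Δ^F(x) = -1/(4π) log(μ² (x² + i0))` with mass scale `μ`:
for `ε = 0` this is the locally integrable function `Δ^F`, and for `ε > 0` it is the smooth function
`Δ^F_ε(x) = -1/(4π) log(μ² (x² + iε))` of which it is the boundary value. -/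
def feynman (μ ε : ℝ) (x : Mink) : ℂ :=
  -(1 / (4 * (Real.pi : ℂ))) *
    Complex.log ((μ : ℂ) ^ 2 * ((minkSq x : ℂ) + (ε : ℂ) * Complex.I))

/-! ### Distributions off the diagonals -/

/-- The set of `n`-tuples of pairwise different points. -/
def offDiag (n : ℕ) : TopologicalSpace.Opens (Fin n → Mink) where
  carrier := {x | Function.Injective x}
  is_open' := by
    have h : {x : Fin n → Mink | Function.Injective x} =
        ⋂ i, ⋂ j, ⋂ _ : i ≠ j, {x : Fin n → Mink | x i ≠ x j} := by
      ext x
      simp only [Set.mem_ofPred_eq, Set.mem_iInter]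
      exact ⟨fun hx i j hij hxy => hij (hx hxy),
        fun hx i j hxy => by_contra fun hij => hx i j hij hxy⟩
    rw [h]
    refine isOpen_iInter_of_finite fun i => isOpen_iInter_of_finite fun j =>
      isOpen_iInter_of_finite fun _ => ?_
    exact isOpen_ne_fun (continuous_apply i) (continuous_apply j)

/-- `u` is the limit, as `ε → 0+`, of the functions `K ε`, in the sense of distributions on the
set of tuples of pairwise different points. -/
def IsBoundaryValue {n : ℕ} (K : ℝ → (Fin n → Mink) → ℂ) (u : 𝓓'(offDiag n, ℂ)) : Prop :=
  ∀ f : 𝓓(offDiag n, ℝ),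
    Tendsto (fun ε : ℝ => ∫ x, K ε x * (f x : ℂ)) (𝓝[>] 0) (𝓝 (u f))

open Classical in
/-- The limit of `K ε` as `ε → 0+` in the sense of distributions (zero if there is none).
Off the diagonals, products of Feynman propagators and of their derivatives, which exist there by
Hörmander's criterion, are the limits of the products of the regularised propagators `Δ^F_ε`, because
`Δ^F_ε → Δ^F` in the spaces of distributions with controlled wave front set, on which
multiplication is continuous. -/
def boundaryValue {n : ℕ} (K : ℝ → (Fin n → Mink) → ℂ) : 𝓓'(offDiag n, ℂ) :=
  if h : ∃ u, IsBoundaryValue K u then h.choose else 0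

/-! ### The sine-Gordon fields -/

/-- The interaction Lagrangian `L_int(x) = cos(a φ(x))`. -/
def lInt (a : ℝ) (x : Mink) : Obs := fun φ => (Real.cos (a * φ.1 x) : ℂ)

/-- `∂f/∂ξ`. -/
def dXi (f : Mink → ℝ) : Mink → ℝ := fun x => deriv (fun s => f (x.1, s)) x.2

/-- `∂/∂ξ` on formal power series in `α`, coefficientwise. -/
def dXiSeries (Φ : PowerSeries (Mink → ℝ)) : PowerSeries (Mink → ℝ) :=
  PowerSeries.mk fun n => dXi (PowerSeries.coeff n Φ)

/-- The formal power series `φ' = ∑ A_ν αᵛ`, `A_0 = φ`, solves the equation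
`½ (φ' + φ)_ξ = (1/α) sin(½ a (φ' - φ))` of the extended Bäcklund transformation (multiplied
by `α`). -/
def IsBacklundSeries (a : ℝ) (φ : Mink → ℝ) (Φ : PowerSeries (Mink → ℝ)) : Prop :=
  PowerSeries.coeff 0 Φ = φ ∧
    PowerSeries.X * dXiSeries ((1 / 2 : ℝ) • (Φ + PowerSeries.C φ)) =
      (PowerSeries.sin (Mink → ℝ)).subst ((a / 2 : ℝ) • (Φ - PowerSeries.C φ))


theorem coeff_sin_subst {B P : PowerSeries (Mink → ℝ)} (hB : PowerSeries.constantCoeff B = 0)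
    {n : ℕ} (hn : 0 < n)
    (hP : ∀ k, PowerSeries.coeff k P = if k < n then PowerSeries.coeff k B else 0) :
    PowerSeries.coeff n ((PowerSeries.sin (Mink → ℝ)).subst B) =
      PowerSeries.coeff n B + PowerSeries.coeff n ((PowerSeries.sin (Mink → ℝ)).subst P) := by
  have hP0 : PowerSeries.constantCoeff P = 0 := by
    rw [← PowerSeries.coeff_zero_eq_constantCoeff_apply, hP, if_pos hn,
      PowerSeries.coeff_zero_eq_constantCoeff_apply, hB]
  have hBs := PowerSeries.HasSubst.of_constantCoeff_zero' hB
  have hPs := PowerSeries.HasSubst.of_constantCoeff_zero' hP0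
  obtain ⟨Q, hQ⟩ : (PowerSeries.X : PowerSeries (Mink → ℝ)) ^ n ∣ B - P := by
    rw [PowerSeries.X_pow_dvd_iff]
    intro m hm
    rw [map_sub, hP, if_pos hm, sub_self]
  have key : ∀ d : ℕ, PowerSeries.coeff d (PowerSeries.sin (Mink → ℝ)) •
        PowerSeries.coeff n (B ^ d) =
      (if d = 1 then PowerSeries.coeff n B else 0) +
        PowerSeries.coeff d (PowerSeries.sin (Mink → ℝ)) • PowerSeries.coeff n (P ^ d) := by
    intro d
    match d with
    | 0 => simp
    | 1 =>
      have : PowerSeries.coeff n P = 0 := by rw [hP, if_neg (lt_irrefl n)]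
      simp [this, PowerSeries.sin]
    | d + 2 =>
      have h2 : PowerSeries.coeff n (B ^ (d + 2)) = PowerSeries.coeff n (P ^ (d + 2)) := by
        rw [← sub_eq_zero, ← map_sub, ← geom_sum₂_mul, hQ, mul_left_comm,
          PowerSeries.coeff_X_pow_mul', if_pos le_rfl, Nat.sub_self,
          PowerSeries.coeff_zero_eq_constantCoeff_apply, map_mul, map_sum]
        rw [Finset.sum_eq_zero, zero_mul]
        intro i hi
        rw [map_mul, map_pow, map_pow, hB, hP0]
        rcases Nat.eq_zero_or_pos i with h0 | h0
        · rw [h0, pow_zero, one_mul]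
          exact zero_pow (by omega)
        · rw [zero_pow h0.ne', zero_mul]
      rw [h2]; simp
  rw [PowerSeries.coeff_subst' hBs, PowerSeries.coeff_subst' hPs, finsum_congr key,
    finsum_add_distrib]
  · congr 1
    rw [finsum_eq_single _ 1 (fun d hd => if_neg hd), if_pos rfl]
  · exact (Set.finite_singleton 1).subset (by
      intro d hd
      by_contra h
      exact hd (if_neg h))
  · exact PowerSeries.coeff_subst_finite' hPs _ _

/-- The part of order less than `n` of `½ a (∑ A_ν αᵛ - A_0)`. -/
def backlundPart (a : ℝ) (n : ℕ) (A : ℕ → Mink → ℝ) : PowerSeries (Mink → ℝ) :=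
  PowerSeries.mk fun k => if k < n then (a / 2 : ℝ) • (A k - if k = 0 then A k else 0) else 0

theorem isBacklundSeries_iff {a : ℝ} (ha : a ≠ 0) (φ : Mink → ℝ) (A : ℕ → Mink → ℝ) :
    IsBacklundSeries a φ (PowerSeries.mk A) ↔ A 0 = φ ∧ ∀ n, A (n + 1) =
      (2 / a : ℝ) • (dXi ((1 / 2 : ℝ) • (A n + if n = 0 then φ else 0)) -
        PowerSeries.coeff (n + 1)
          ((PowerSeries.sin (Mink → ℝ)).subst (backlundPart a (n + 1) A))) := by
  unfold IsBacklundSeries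
  rw [PowerSeries.coeff_mk]
  refine and_congr_right fun h0 => ?_
  have hB : PowerSeries.constantCoeff
      ((a / 2 : ℝ) • (PowerSeries.mk A - PowerSeries.C φ)) = 0 := by
    rw [← PowerSeries.coeff_zero_eq_constantCoeff_apply, PowerSeries.coeff_smul, map_sub,
      PowerSeries.coeff_mk, PowerSeries.coeff_C, if_pos rfl, h0, sub_self, smul_zero]
  have hstep : ∀ n, PowerSeries.coeff (n + 1) ((PowerSeries.sin (Mink → ℝ)).subst
        ((a / 2 : ℝ) • (PowerSeries.mk A - PowerSeries.C φ))) =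
      (a / 2 : ℝ) • A (n + 1) + PowerSeries.coeff (n + 1)
          ((PowerSeries.sin (Mink → ℝ)).subst (backlundPart a (n + 1) A)) := by
    intro n
    rw [coeff_sin_subst hB (Nat.succ_pos n) (P := backlundPart a (n + 1) A)]
    · simp
    · intro k
      by_cases hk : k < n + 1
      · by_cases hk0 : k = 0
        · subst hk0
          simp [backlundPart, h0]
        · simp [backlundPart, PowerSeries.coeff_C, hk0]
      · rw [if_neg hk, backlundPart, PowerSeries.coeff_mk, if_neg hk]
  have hleft : ∀ n, PowerSeries.coeff (n + 1) (PowerSeries.X *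
        dXiSeries ((1 / 2 : ℝ) • (PowerSeries.mk A + PowerSeries.C φ))) =
      dXi ((1 / 2 : ℝ) • (A n + if n = 0 then φ else 0)) := by
    intro n
    rw [PowerSeries.coeff_succ_X_mul, dXiSeries, PowerSeries.coeff_mk, PowerSeries.coeff_smul,
      map_add, PowerSeries.coeff_mk, PowerSeries.coeff_C]
  have haux : ∀ x y z : Mink → ℝ, y = (a / 2 : ℝ) • x + z ↔ x = (2 / a : ℝ) • (y - z) := by
    intro x y z
    constructor
    · rintro rfl
      rw [add_sub_cancel_right, smul_smul]
      rw [show 2 / a * (a / 2) = 1 by field_simp, one_smul]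
    · rintro rfl
      rw [smul_smul, show a / 2 * (2 / a) = 1 by field_simp, one_smul, sub_add_cancel]
  constructor
  · intro h n
    rw [← haux, ← hstep, ← hleft, h]
  · intro h
    ext1 m
    rcases m with _ | n
    · rw [PowerSeries.coeff_zero_X_mul, PowerSeries.coeff_zero_eq_constantCoeff_apply]
      exact (PowerSeries.constantCoeff_subst_eq_zero hB _ (by
        rw [← PowerSeries.coeff_zero_eq_constantCoeff_apply]
        simp [PowerSeries.sin])).symm
    · rw [hleft, hstep, haux, ← h n]

theorem backlundPart_congr {a : ℝ} {n : ℕ} {A A' : ℕ → Mink → ℝ} (h : ∀ k < n, A k = A' k) :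
    backlundPart a n A = backlundPart a n A' := by
  ext1 k
  by_cases hk : k < n
  · simp [backlundPart, hk, h k hk]
  · simp [backlundPart, hk]

/-- The coefficients `A_ν` computed one after the other. -/
def backlundRec (a : ℝ) (φ : Mink → ℝ) : ℕ → Mink → ℝ
  | 0 => φ
  | n + 1 => (2 / a : ℝ) • (dXi ((1 / 2 : ℝ) • (backlundRec a φ n + if n = 0 then φ else 0)) -
        PowerSeries.coeff (n + 1) ((PowerSeries.sin (Mink → ℝ)).subst
          (backlundPart a (n + 1) fun k => if _h : k < n + 1 then backlundRec a φ k else 0)))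

theorem existsUnique_backlundSeries {a : ℝ} (ha : a ≠ 0) (φ : Mink → ℝ) :
    ∃! Φ, IsBacklundSeries a φ Φ := by
  refine ⟨PowerSeries.mk (backlundRec a φ), ?_, ?_⟩
  · refine (isBacklundSeries_iff ha φ _).2 ⟨by rw [backlundRec], fun n => ?_⟩
    rw [backlundRec]
    congr 4
    exact backlundPart_congr fun k hk => by simp [hk]
  · intro Φ hΦ
    obtain ⟨A, rfl⟩ : ∃ A, Φ = PowerSeries.mk A :=
      ⟨fun n => PowerSeries.coeff n Φ, by ext1 n; simp⟩
    obtain ⟨h0, h1⟩ := (isBacklundSeries_iff ha φ A).1 hΦ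
    have : ∀ n, A n = backlundRec a φ n := by
      intro n
      induction n using Nat.strong_induction_on with
      | _ n ih =>
        rcases n with _ | n
        · rw [h0, backlundRec]
        · rw [h1, backlundRec, ih n (Nat.lt_succ_self n)]
          congr 4
          exact backlundPart_congr fun k hk => by simp [hk, ih k hk]
    rw [funext this]

open Classical in
/-- The formal power series `φ' = B̂_α φ = ∑ A_ν αᵛ`: the unique solution of the equation of the
extended Bäcklund transformation (for `a ≠ 0`). -/
def backlundSeries (a : ℝ) (φ : Mink → ℝ) : PowerSeries (Mink → ℝ) :=
  if h : ∃ Φ, IsBacklundSeries a φ Φ then h.choose else 0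

/-- The power series `α² s₂^{(α)} = 2 - cos(½ a (φ - B̂_{-α} φ)) - cos(½ a (φ - B̂_α φ))`. -/
def currentSeries (a : ℝ) (φ : Mink → ℝ) : PowerSeries (Mink → ℝ) :=
  2 - (PowerSeries.cos (Mink → ℝ)).subst ((a / 2 : ℝ) •
        (PowerSeries.C φ - PowerSeries.rescale (-1 : Mink → ℝ) (backlundSeries a φ)))
    - (PowerSeries.cos (Mink → ℝ)).subst ((a / 2 : ℝ) •
        (PowerSeries.C φ - backlundSeries a φ))

/-- The field `s₂^N(x)`: the coefficient of `α^{2N}` in `s₂^{(α)}`, at the point `x`. -/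
def s2 (a : ℝ) (N : ℕ) (x : Mink) : Obs :=
  fun φ => (PowerSeries.coeff (2 * N + 2) (currentSeries a φ.1) x : ℂ)

/-! ### The two sides of the expansion -/

/-- The regularised coefficient of `ħ^p` in `T_{l+1}(L_int(x₁) ⊗ ⋯ ⊗ L_int(x_l) ⊗ s₂^N(x_{l+1}))`,
evaluated at the configuration `φ`. -/
def lhsKernel (a μ : ℝ) (l N : ℕ) (φ : Conf) (p : ℕ) (ε : ℝ) (x : Fin (l + 1) → Mink) : ℂ :=
  PowerSeries.coeff p (timeOrdered (feynman μ ε) (l + 1)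
    (Fin.snoc (fun i : Fin l => PowerSeries.C (lInt a (x i.castSucc)))
      (PowerSeries.C (s2 a N (x (Fin.last l)))))) φ

/-- The regularised coefficient of `ħ^q` in
`(Δ^F)^j T_l(δ^{j₁}L_int/δφ^{j₁}(x₁) ⊗ ⋯ ⊗ δ^{j_l}L_int/δφ^{j_l}(x_l)) δ^j s₂^N/δφ^j(x_{l+1})`, where
`j = j₁ + ⋯ + j_l`, evaluated at `φ`. The `j = j₁ + ⋯ + j_l` arguments of the functional derivatives
of the interaction Lagrangians are distributed over the factors in consecutive blocks, and each of
them is joined by one propagator to one of the arguments of the `j`-th functional derivative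
of `s₂^N`. -/
def termKernel (a μ : ℝ) (l N : ℕ) (φ : Conf) (J : Fin l → ℕ) (q : ℕ) (ε : ℝ)
    (x : Fin (l + 1) → Mink) : ℂ :=
  pairing (∑ i, J i) (feynman μ ε)
    (fun h => PowerSeries.coeff q (timeOrdered (feynman μ ε) l (fun i =>
      PowerSeries.C (funcDeriv (J i) (fun k => h (finSigmaFinEquiv ⟨i, k⟩))
        (lInt a (x i.castSucc))))) φ)
    (fun h => funcDeriv (∑ i, J i) h (s2 a N (x (Fin.last l))) φ)

/-- The unrenormalized `T_{l+1}(L_int^{⊗l} ⊗ s₂^N)`, evaluated at `φ`, as a formal power series in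
`ħ` (a sequence of coefficients) of distributions. -/
def unrenormT (a μ : ℝ) (l N : ℕ) (φ : Conf) : ℕ → 𝓓'(offDiag (l + 1), ℂ) :=
  fun p => boundaryValue (lhsKernel a μ l N φ p)

/-- The term `(Δ^F)^j T_l(δ^{j₁}L_int ⊗ ⋯ ⊗ δ^{j_l}L_int) δ^j s₂^N`, `J = (j₁,…,j_l)`, evaluated at
`φ`, as a formal power series in `ħ` of distributions. -/
def unrenormTerm (a μ : ℝ) (l N : ℕ) (φ : Conf) (J : Fin l → ℕ) : ℕ → 𝓓'(offDiag (l + 1), ℂ) :=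
  fun q => boundaryValue (termKernel a μ l N φ J q)

/-- Multiplication of a formal power series in `ħ` by `ħ^j`. -/
def hbarPow {V : Type*} [Zero V] (j : ℕ) (u : ℕ → V) : ℕ → V :=
  fun p => if j ≤ p then u (p - j) else 0

end

end SineGordon

/-!
Away from the diagonals the regularised propagator `Δ^F_ε` continues analytically along the
simultaneous Wick rotation of all points by an angle `θ ∈ [0, π/4]`, with bounds `O(θ⁻ᴹ)` that are
uniform in `ε`. As the rotation is generated by boosts, which preserve Lebesgue measure, integration
by parts moves the `θ`-derivatives of the smeared kernel to the test function. So these derivatives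
obey the same bounds to every order, and integrating back from `θ = π/4` to `0` sufficiently often
gives convergence as `ε → 0⁺`. By Banach–Steinhaus the limit is a distribution.

The expansion itself already holds for `ε > 0`: `cos (a φ)` is a sum of two exponentials, whose
functional derivatives are multiplicative, so that the time-ordered products of the interaction are
explicit; and `s₂^N` is a polynomial of degree at most `2 N + 2` in the `ξ`-derivatives of `φ`, so
that its functional derivatives of higher order vanish. What remains is to sort the ways of joining
each derivative of `s₂^N` to one of the `l` vertices by the numbers `j₁, …, j_l` of joins.
-/

namespace SineGordon

noncomputable section

section IntegrationByParts

variable {E F : Type*} [NormedAddCommGroup E] [NormedSpace ℝ E] [FiniteDimensional ℝ E]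
  [MeasurableSpace E] [BorelSpace E] [NormedAddCommGroup F] [NormedSpace ℝ F]

theorem integral_fderiv_apply_clm (ν : Measure E) [ν.IsAddHaarMeasure] (A : E →L[ℝ] E)
    {g : E → F} (hg : ContDiff ℝ 1 g) (hc : HasCompactSupport g) :
    ∫ x, fderiv ℝ g x (A x) ∂ν = -LinearMap.trace ℝ E A • ∫ x, g x ∂ν := by
  let b := Module.finBasis ℝ E
  let c (i) : E →L[ℝ] ℝ := (b.coord i ∘ₗ A.toLinearMap).toContinuousLinearMap
  have hexpand (x : E) : fderiv ℝ g x (A x) = ∑ i, c i x • fderiv ℝ g x (b i) := by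
    conv_lhs => rw [← b.sum_repr (A x), map_sum]
    simp [c]
  have hcont (v : E) : Continuous fun x => fderiv ℝ g x v :=
    (hg.continuous_fderiv (by norm_num)).clm_apply continuous_const
  have hsupp (v : E) : HasCompactSupport fun x => fderiv ℝ g x v :=
    (hc.fderiv ℝ).comp_left (g := fun L : E →L[ℝ] F => L v) rfl
  have hint (i) : Integrable (fun x => c i x • fderiv ℝ g x (b i)) ν :=
    ((c i).continuous.smul (hcont _)).integrable_of_hasCompactSupport (hsupp _).smul_left
  have hparts (i) : ∫ x, c i x • fderiv ℝ g x (b i) ∂ν = -(c i (b i) • ∫ x, g x ∂ν) := by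
    rw [integral_smul_fderiv_eq_neg_fderiv_smul_of_integrable _ (hint i) _
      (fun x _ => (c i).differentiableAt) (fun x _ => hg.differentiable (by norm_num) x)]
    · simp [integral_smul]
    · simp only [ContinuousLinearMap.fderiv]
      exact (hg.continuous.integrable_of_hasCompactSupport hc).smul (c i (b i))
    · exact ((c i).continuous.smul hg.continuous).integrable_of_hasCompactSupport hc.smul_left
  have htrace : LinearMap.trace ℝ E A = ∑ i, c i (b i) := by
    simp [LinearMap.trace_eq_matrix_trace ℝ b, Matrix.trace, LinearMap.toMatrix_apply, c]
  simp_rw [hexpand]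
  rw [integral_finsetSum _ fun i _ => hint i, htrace, neg_smul, Finset.sum_smul,
    ← Finset.sum_neg_distrib]
  exact Finset.sum_congr rfl fun i _ => hparts i

theorem integral_fderiv_clm_mul_of_trace_eq_zero (ν : Measure E) [ν.IsAddHaarMeasure]
    {A : E →L[ℝ] E} (hA : LinearMap.trace ℝ E A = 0) {f g : E → ℂ} (hf : ContDiff ℝ 1 f)
    (hg : ContDiff ℝ 1 g) (hc : HasCompactSupport g) :
    ∫ x, fderiv ℝ f x (A x) * g x ∂ν = -∫ x, f x * fderiv ℝ g x (A x) ∂ν := by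
  have hcont {h : E → ℂ} (hh : ContDiff ℝ 1 h) : Continuous fun x => fderiv ℝ h x (A x) :=
    (hh.continuous_fderiv (by norm_num)).clm_apply A.continuous
  have hsupp : HasCompactSupport fun x => fderiv ℝ g x (A x) :=
    (hc.fderiv ℝ).mono fun x hx h0 => hx (by simp [h0])
  have hleibniz (x : E) : fderiv ℝ (f * g) x (A x) =
      fderiv ℝ f x (A x) * g x + f x * fderiv ℝ g x (A x) := by
    rw [fderiv_mul (hf.differentiable (by norm_num) x) (hg.differentiable (by norm_num) x)]
    simp [mul_comm, add_comm]
  have hzero := integral_fderiv_apply_clm ν A (g := f * g) (hf.mul hg) hc.mul_left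
  simp_rw [hleibniz, hA] at hzero
  have hsum : ∫ x, fderiv ℝ f x (A x) * g x + f x * fderiv ℝ g x (A x) ∂ν =
      ∫ x, fderiv ℝ f x (A x) * g x ∂ν + ∫ x, f x * fderiv ℝ g x (A x) ∂ν :=
    integral_add (((hcont hf).mul hg.continuous).integrable_of_hasCompactSupport hc.mul_left)
      ((hf.continuous.mul (hcont hg)).integrable_of_hasCompactSupport hsupp.mul_left)
  exact eq_neg_of_add_eq_zero_left (hsum.symm.trans (by simpa using hzero))

end IntegrationByParts

section TaylorFromEndpoint

variable {E : Type*} [NormedAddCommGroup E] [NormedSpace ℝ E]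

theorem hasDerivAt_sum_taylor {Ψ : ℕ → ℝ → E} {a θ : ℝ} (M : ℕ)
    (hd : ∀ n, HasDerivAt (Ψ n) (Ψ (n + 1) θ) θ) :
    HasDerivAt (fun θ => ∑ n ∈ Finset.range (M + 1), ((a - θ) ^ n / n.factorial) • Ψ n θ)
      (((a - θ) ^ M / M.factorial) • Ψ (M + 1) θ) θ := by
  have hpow (n : ℕ) : HasDerivAt (fun θ : ℝ => (a - θ) ^ (n + 1) / (n + 1).factorial)
      (-((a - θ) ^ n / n.factorial)) θ := by
    refine ((((hasDerivAt_id θ).const_sub a).pow (n + 1)).div_const _).congr_deriv ?_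
    rw [Nat.factorial_succ]
    push_cast
    have : (n.factorial : ℝ) ≠ 0 := by positivity
    simp only [id]
    field_simp
  induction M with
  | zero => simpa using hd 0
  | succ M ih =>
    simp_rw [Finset.sum_range_succ _ (M + 1)]
    refine (ih.add ((hpow M).smul (hd (M + 1)))).congr_deriv ?_
    rw [neg_smul, add_neg_cancel_comm_assoc]

theorem taylor_eq_sum_sub_integral [CompleteSpace E] {Ψ : ℕ → ℝ → E} {a b : ℝ} (hab : a ≤ b)
    (hc : ∀ n, ContinuousOn (Ψ n) (Set.Icc a b))
    (hd : ∀ n, ∀ θ ∈ Set.Ioo a b, HasDerivAt (Ψ n) (Ψ (n + 1) θ) θ) (M : ℕ) :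
    Ψ 0 a = ∑ n ∈ Finset.range (M + 1), ((a - b) ^ n / n.factorial) • Ψ n b -
      ∫ θ in a..b, ((a - θ) ^ M / M.factorial) • Ψ (M + 1) θ := by
  have hcoeff (n : ℕ) : Continuous fun θ : ℝ => (a - θ) ^ n / n.factorial := by fun_prop
  rw [intervalIntegral.integral_eq_sub_of_hasDerivAt_of_le hab
    (f := fun θ => ∑ n ∈ Finset.range (M + 1), ((a - θ) ^ n / n.factorial) • Ψ n θ)
    (continuousOn_finsetSum _ fun n _ => (hcoeff n).continuousOn.smul (hc n))
    (fun θ hθ => hasDerivAt_sum_taylor M fun n => hd n θ hθ)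
    (((hcoeff M).continuousOn.smul (hc (M + 1))).intervalIntegrable_of_Icc hab), sub_sub_cancel,
    Finset.sum_range_succ', Finset.sum_eq_zero fun n _ => by simp]
  simp

/-- A singularity of finite order at the endpoint `a` is killed by the weight `(a - θ)ᴹ` of the
Taylor remainder, which is then under dominated convergence. -/
theorem exists_tendsto_endpoint_of_pow_mul_norm_le [CompleteSpace E] {ι : Type*} {l : Filter ι}
    [l.IsCountablyGenerated] {a b : ℝ} (hab : a < b) {Ψ : ι → ℕ → ℝ → E} {B : ℕ → ℝ} {M : ℕ}
    (hc : ∀ᶠ i in l, ∀ n, ContinuousOn (Ψ i n) (Set.Icc a b))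
    (hd : ∀ᶠ i in l, ∀ n, ∀ θ ∈ Set.Ioo a b, HasDerivAt (Ψ i n) (Ψ i (n + 1) θ) θ)
    (hbound : ∀ᶠ i in l, ∀ n, ∀ θ ∈ Set.Ioc a b, (θ - a) ^ M * ‖Ψ i n θ‖ ≤ B n)
    (hlim : ∀ n, ∀ θ ∈ Set.Ioc a b, ∃ c, Tendsto (fun i => Ψ i n θ) l (𝓝 c)) :
    ∃ c, Tendsto (fun i => Ψ i 0 a) l (𝓝 c) := by
  choose! c hcl using hlim
  have hremainder : Tendsto (fun i => ∫ θ in a..b, ((a - θ) ^ M / M.factorial) • Ψ i (M + 1) θ)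
      l (𝓝 (∫ θ in a..b, ((a - θ) ^ M / M.factorial) • c (M + 1) θ)) := by
    refine intervalIntegral.tendsto_integral_filter_of_dominated_convergence (fun _ => B (M + 1))
      ?_ ?_ (by simp) (.of_forall fun θ hθ => ?_)
    · filter_upwards [hc] with i hi
      refine ContinuousOn.aestronglyMeasurable ?_ measurableSet_uIoc
      rw [Set.uIoc_of_le hab.le]
      exact (Continuous.continuousOn (by fun_prop)).smul
        ((hi (M + 1)).mono Set.Ioc_subset_Icc_self)
    · filter_upwards [hbound] with i hi
      refine .of_forall fun θ hθ => ?_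
      rw [Set.uIoc_of_le hab.le] at hθ
      refine le_trans ?_ (hi (M + 1) θ hθ)
      rw [norm_smul, norm_div, norm_pow, norm_sub_rev, Real.norm_of_nonneg (sub_nonneg.2 hθ.1.le),
        Real.norm_natCast]
      gcongr
      exact div_le_self (pow_nonneg (sub_nonneg.2 hθ.1.le) _)
        (by exact_mod_cast M.factorial_pos)
    · rw [Set.uIoc_of_le hab.le] at hθ
      exact (hcl (M + 1) θ hθ).const_smul _
  refine ⟨_, ((tendsto_finsetSum (Finset.range (M + 1)) fun n _ =>
    (hcl n b ⟨hab, le_rfl⟩).const_smul ((a - b) ^ n / n.factorial : ℝ)).sub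
      hremainder).congr' ?_⟩
  filter_upwards [hc, hd] with i hi hi'
  exact (taylor_eq_sum_sub_integral hab.le hi hi' M).symm

end TaylorFromEndpoint

section TestFunctionSpaces

variable {E F : Type*} [NormedAddCommGroup E] [NormedSpace ℝ E] [NormedAddCommGroup F]
  [NormedSpace ℝ F]

theorem hasFTaylorSeriesUpTo_of_tendstoUniformly {ι : Type*} {l : Filter ι} [l.NeBot]
    {f : ι → E → F} {p : ι → E → FormalMultilinearSeries ℝ E F}
    {q : E → FormalMultilinearSeries ℝ E F} (hp : ∀ i, HasFTaylorSeriesUpTo ∞ (f i) (p i))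
    (hq : ∀ m, TendstoUniformly (fun i x => p i x m) (fun x => q x m) l) :
    HasFTaylorSeriesUpTo ∞ (fun x => (q x 0).curry0) q where
  zero_eq _ := rfl
  fderiv m _ x := by
    let curry : (E [×(m + 1)]→L[ℝ] F) →L[ℝ] E →L[ℝ] (E [×m]→L[ℝ] F) :=
      (continuousMultilinearCurryLeftEquiv ℝ (fun _ : Fin (m + 1) => E) F).toContinuousLinearEquiv
    exact hasFDerivAt_of_tendstoUniformlyOn isOpen_univ
      (curry.uniformContinuous.comp_tendstoUniformly (hq (m + 1))).tendstoUniformlyOn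
      (fun i y _ => (hp i).fderiv m (by exact_mod_cast ENat.natCast_lt_top m) y)
      (fun y _ => (hq m).tendsto_at y) (Set.mem_univ x)
  cont m _ := (hq m).continuous
    (Frequently.of_forall fun i => (hp i).cont m (by exact_mod_cast le_top))

theorem isClosed_range_pi_structureMapCLM (K : TopologicalSpace.Compacts E) :
    IsClosed (Set.range (ContinuousLinearMap.pi
      (ContDiffMapSupportedIn.structureMapCLM ℝ (E := E) (F := F) (K := K) ⊤))) := by
  refine IsSeqClosed.isClosed fun T T₀ hT hlim => ?_
  choose f hf using hT
  have hcoord (m : ℕ) : TendstoUniformly (fun i x => iteratedFDeriv ℝ m (f i) x)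
      (fun x => T₀ m x) atTop := by
    have hT (i) : iteratedFDeriv ℝ m (f i) = T i m := by
      rw [← hf i]
      exact (ContDiffMapSupportedIn.structureMapCLM_top_apply ℝ (f i)).symm
    simp_rw [hT]
    exact BoundedContinuousFunction.tendsto_iff_tendstoUniformly.1 (tendsto_pi_nhds.1 hlim m)
  have hseries := hasFTaylorSeriesUpTo_of_tendstoUniformly (q := fun x m => T₀ m x)
    (fun i => contDiff_iff_ftaylorSeries.1 (f i).contDiff) hcoord
  have hzero : Set.EqOn (fun x => (T₀ 0 x).curry0) 0 (K : Set E)ᶜ := fun x hx => by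
    have h : T₀ 0 x = 0 := tendsto_nhds_unique ((hcoord 0).tendsto_at x) (by
      simp [(f _).iteratedFDeriv_zero_on_compl hx])
    simp [h]
  refine ⟨⟨fun x => (T₀ 0 x).curry0, hseries.contDiff, hzero⟩, ?_⟩
  ext m x : 2
  refine (congrFun (ContDiffMapSupportedIn.structureMapCLM_top_apply ℝ _) x).trans ?_
  exact (hseries.eq_iteratedFDeriv (by exact_mod_cast le_top) x).symm

instance completeSpace_contDiffMapSupportedIn (K : TopologicalSpace.Compacts E) [CompleteSpace F] :
    CompleteSpace 𝓓_{K}(E, F) := by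
  have h := ContDiffMapSupportedIn.isUniformEmbedding_pi_structureMapCLM ℝ (E := E) (F := F)
    (K := K) (n := ⊤)
  exact h.isUniformInducing.completeSpace (isClosed_range_pi_structureMapCLM K).isComplete

instance barrelledSpace_contDiffMapSupportedIn (K : TopologicalSpace.Compacts E) [CompleteSpace F] :
    BarrelledSpace ℝ 𝓓_{K}(E, F) := by
  have h := ContDiffMapSupportedIn.isUniformEmbedding_pi_structureMapCLM ℝ (E := E) (F := F)
    (K := K) (n := ⊤)
  have : (uniformity 𝓓_{K}(E, F)).IsCountablyGenerated := by
    rw [← h.comap_uniformity]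
    infer_instance
  infer_instance

end TestFunctionSpaces

section BoundaryValues

theorem exists_testFunctionCLM_of_tendsto {E F V ι : Type*} [NormedAddCommGroup E]
    [NormedSpace ℝ E] {Ω : TopologicalSpace.Opens E} [NormedAddCommGroup F] [NormedSpace ℝ F]
    [CompleteSpace F] [NormedAddCommGroup V] [NormedSpace ℝ V] {l : Filter ι} [l.NeBot]
    [l.IsCountablyGenerated] (u : ι → 𝓓(Ω, F) →L[ℝ] V)
    (h : ∀ f, ∃ c, Tendsto (fun i => u i f) l (𝓝 c)) :
    ∃ v : 𝓓(Ω, F) →L[ℝ] V, ∀ f, Tendsto (fun i => u i f) l (𝓝 (v f)) := by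
  choose c hc using h
  let v : 𝓓(Ω, F) →ₗ[ℝ] V :=
    linearMapOfTendsto c (fun i => (u i).toLinearMap) (tendsto_pi_nhds.2 hc)
  refine ⟨⟨v, (TestFunction.continuous_iff_continuous_comp v).2 fun K hK => ?_⟩, hc⟩
  exact (continuousLinearMapOfTendsto (fun i => (u i).comp (TestFunction.ofSupportedInCLM ℝ hK))
    (tendsto_pi_nhds.2 fun f => hc (TestFunction.ofSupportedInCLM ℝ hK f))).continuous

variable {n : ℕ} {κ κ' : ℝ → (Fin n → Mink) → ℂ} {u u' : 𝓓'(offDiag n, ℂ)}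

/-- The kernels are continuous for `ε > 0` and have the boundary value `u`. Continuity makes their
integrals against test functions exist, so that boundary values can be added. -/
def IsContinuousBoundaryValue (κ : ℝ → (Fin n → Mink) → ℂ) (u : 𝓓'(offDiag n, ℂ)) : Prop :=
  (∀ ε > 0, Continuous (κ ε)) ∧ IsBoundaryValue κ u

theorem exists_isContinuousBoundaryValue_of_tendsto (hκ : ∀ ε > 0, Continuous (κ ε))
    (h : ∀ f : 𝓓(offDiag n, ℝ), ∃ c, Tendsto (fun ε => ∫ x, κ ε x * (f x : ℂ)) (𝓝[>] 0) (𝓝 c)) :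
    ∃ u, IsContinuousBoundaryValue κ u := by
  let w (ε : ℝ) : 𝓓(offDiag n, ℝ) →L[ℝ] ℂ :=
    TestFunction.integralAgainstBilinCLM (ContinuousLinearMap.lsmul ℝ ℝ) volume (κ ε)
  have hw (f : 𝓓(offDiag n, ℝ)) :
      (fun ε => w ε f) =ᶠ[𝓝[>] 0] fun ε => ∫ x, κ ε x * (f x : ℂ) := by
    filter_upwards [self_mem_nhdsWithin] with ε hε
    have hloc : LocallyIntegrableOn (κ ε) (offDiag n) :=
      (hκ ε hε).locallyIntegrable.locallyIntegrableOn _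
    simp [w, hloc, mul_comm]
  obtain ⟨u, hu⟩ := exists_testFunctionCLM_of_tendsto w fun f => (h f).imp fun c hc =>
    hc.congr' (hw f).symm
  exact ⟨u, hκ, fun f => (hu f).congr' (hw f)⟩

theorem IsBoundaryValue.boundaryValue_eq (h : IsBoundaryValue κ u) : boundaryValue κ = u := by
  have hex : ∃ u, IsBoundaryValue κ u := ⟨u, h⟩
  rw [boundaryValue, dif_pos hex]
  exact DFunLike.ext _ _ fun f => tendsto_nhds_unique (hex.choose_spec f) (h f)

namespace IsContinuousBoundaryValue

theorem congr (h : IsContinuousBoundaryValue κ u) (hκ : ∀ ε > 0, κ' ε = κ ε) :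
    IsContinuousBoundaryValue κ' u := by
  refine ⟨fun ε hε => hκ ε hε ▸ h.1 ε hε, fun f => (h.2 f).congr' ?_⟩
  filter_upwards [self_mem_nhdsWithin] with ε hε
  rw [hκ ε hε]

theorem integrable (h : IsContinuousBoundaryValue κ u) {ε : ℝ} (hε : 0 < ε)
    (f : 𝓓(offDiag n, ℝ)) : Integrable fun x => κ ε x * (f x : ℂ) :=
  ((h.1 ε hε).mul (Complex.continuous_ofReal.comp f.continuous)).integrable_of_hasCompactSupport
    (f.hasCompactSupport.comp_left Complex.ofReal_zero).mul_left

theorem zero : IsContinuousBoundaryValue (n := n) (fun _ _ => 0) 0 :=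
  ⟨fun _ _ => continuous_const, fun f => by simp⟩

theorem add (h : IsContinuousBoundaryValue κ u) (h' : IsContinuousBoundaryValue κ' u') :
    IsContinuousBoundaryValue (fun ε x => κ ε x + κ' ε x) (u + u') := by
  refine ⟨fun ε hε => (h.1 ε hε).add (h'.1 ε hε), fun f => ((h.2 f).add (h'.2 f)).congr' ?_⟩
  filter_upwards [self_mem_nhdsWithin] with ε hε
  rw [← integral_add (h.integrable hε f) (h'.integrable hε f)]
  simp_rw [add_mul]

theorem smul (h : IsContinuousBoundaryValue κ u) (r : ℝ) :
    IsContinuousBoundaryValue (fun ε x => (r : ℂ) * κ ε x) (r • u) := by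
  refine ⟨fun ε hε => continuous_const.mul (h.1 ε hε),
    fun f => ((h.2 f).const_smul r).congr fun ε => ?_⟩
  simp_rw [mul_assoc]
  rw [integral_const_mul, Complex.real_smul]

theorem sum {ι : Type*} (s : Finset ι) {κ : ι → ℝ → (Fin n → Mink) → ℂ}
    {u : ι → 𝓓'(offDiag n, ℂ)} (h : ∀ i ∈ s, IsContinuousBoundaryValue (κ i) (u i)) :
    IsContinuousBoundaryValue (fun ε x => ∑ i ∈ s, κ i ε x) (∑ i ∈ s, u i) := by
  classical
  induction s using Finset.induction_on with
  | empty => simpa using zero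
  | insert i s hi ih =>
    simp_rw [Finset.sum_insert hi]
    exact (h i (Finset.mem_insert_self i s)).add
      (ih fun j hj => h j (Finset.mem_insert_of_mem hj))

end IsContinuousBoundaryValue

end BoundaryValues

section WickRotation

/-- The hyperbolic rotation of the Minkowski plane by the imaginary angle `iθ`. -/
def wickCLM (θ : ℝ) : Mink →L[ℝ] ℂ × ℂ :=
  ((Real.cos θ • Complex.ofRealCLM.comp (ContinuousLinearMap.fst ℝ ℝ ℝ)) +
    (Complex.I * Real.sin θ) • Complex.ofRealCLM.comp (ContinuousLinearMap.snd ℝ ℝ ℝ)).prod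
  ((Real.cos θ • Complex.ofRealCLM.comp (ContinuousLinearMap.snd ℝ ℝ ℝ)) +
    (Complex.I * Real.sin θ) • Complex.ofRealCLM.comp (ContinuousLinearMap.fst ℝ ℝ ℝ))

theorem wickCLM_apply (θ : ℝ) (z : Mink) :
    wickCLM θ z = ((Real.cos θ : ℂ) * z.1 + Complex.I * Real.sin θ * z.2,
      (Real.cos θ : ℂ) * z.2 + Complex.I * Real.sin θ * z.1) := by
  simp [wickCLM]

variable {n : ℕ}

/-- The simultaneous Wick rotation of all points of a tuple. -/
def wickTuple (θ : ℝ) : (Fin n → Mink) →L[ℝ] (Fin n → ℂ × ℂ) :=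
  ContinuousLinearMap.pi fun i => (wickCLM θ).comp (ContinuousLinearMap.proj i)

@[simp]
theorem wickTuple_apply (θ : ℝ) (x : Fin n → Mink) (i : Fin n) :
    wickTuple θ x i = wickCLM θ (x i) := rfl

/-- The generator `(τ, ξ) ↦ (ξ, τ)` of the hyperbolic rotations, acting on all points of a
tuple. -/
def boost : (Fin n → Mink) →L[ℝ] (Fin n → Mink) :=
  ContinuousLinearMap.pi fun i =>
    ((ContinuousLinearMap.snd ℝ ℝ ℝ).prod (ContinuousLinearMap.fst ℝ ℝ ℝ)).comp
      (ContinuousLinearMap.proj i)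

@[simp]
theorem boost_apply (x : Fin n → Mink) (i : Fin n) : boost x i = ((x i).2, (x i).1) := rfl

theorem trace_boost : LinearMap.trace ℝ (Fin n → Mink) (boost (n := n)) = 0 := by
  let r : (Fin n → Mink) ≃ₗ[ℝ] (Fin n → Mink) :=
    LinearEquiv.piCongrRight fun _ => (LinearEquiv.refl ℝ ℝ).prodCongr (LinearEquiv.neg ℝ)
  have hr : r.conj (boost (n := n)).toLinearMap = -(boost (n := n)).toLinearMap := by
    ext x i <;> simp [r, LinearEquiv.conj_apply]
  have := LinearMap.trace_conj' (boost (n := n)).toLinearMap r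
  rw [hr, map_neg] at this
  linarith

theorem hasDerivAt_wickTuple (θ : ℝ) (x : Fin n → Mink) :
    HasDerivAt (fun t => wickTuple t x) (Complex.I • wickTuple θ (boost x)) θ := by
  rw [hasDerivAt_pi]
  intro i
  have hcos : HasDerivAt (fun t : ℝ => (Real.cos t : ℂ)) (-(Real.sin θ : ℂ)) θ := by
    simpa using (Real.hasDerivAt_cos θ).ofReal_comp
  have hsin : HasDerivAt (fun t : ℝ => (Real.sin t : ℂ)) (Real.cos θ : ℂ) θ :=
    (Real.hasDerivAt_sin θ).ofReal_comp
  have hcomp (p q : ℂ) : HasDerivAt (fun t : ℝ => (Real.cos t : ℂ) * p + Complex.I * Real.sin t * q)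
      (Complex.I * ((Real.cos θ : ℂ) * q + Complex.I * Real.sin θ * p)) θ := by
    refine ((hcos.mul_const p).add ((hsin.const_mul Complex.I).mul_const q)).congr_deriv ?_
    linear_combination (-(Real.sin θ : ℂ) * p) * Complex.I_sq
  simp only [wickTuple_apply, wickCLM_apply, Pi.smul_apply, boost_apply, Prod.smul_mk]
  exact (hcomp _ _).prodMk (hcomp _ _)

theorem continuous_wickTuple_uncurry :
    Continuous fun p : ℝ × (Fin n → Mink) => wickTuple p.1 p.2 := by
  refine continuous_pi fun i => ?_
  simp only [wickTuple_apply, wickCLM_apply]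
  fun_prop

end WickRotation

section ParametricIntegral

theorem hasDerivAt_integral_of_compact_support {X E : Type*} [TopologicalSpace X] [T2Space X]
    [MeasurableSpace X] [OpensMeasurableSpace X] [NormedAddCommGroup E] [NormedSpace ℝ E]
    [SecondCountableTopologyEither X E] {ν : Measure X} [IsFiniteMeasureOnCompacts ν]
    {F F' : ℝ → X → E} {s : Set ℝ} {K : Set X} {θ : ℝ} (hK : IsCompact K) (hs : IsCompact s)
    (hθ : s ∈ 𝓝 θ) (hF : ∀ t ∈ s, Continuous (F t))
    (hF' : ContinuousOn (Function.uncurry F') (s ×ˢ Set.univ))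
    (hd : ∀ t ∈ s, ∀ x, HasDerivAt (fun t => F t x) (F' t x) t)
    (hFK : ∀ x ∉ K, ∀ t, F t x = 0) (hFK' : ∀ x ∉ K, ∀ t, F' t x = 0) :
    HasDerivAt (fun t => ∫ x, F t x ∂ν) (∫ x, F' θ x ∂ν) θ := by
  have hθs := mem_of_mem_nhds hθ
  obtain ⟨C, hC⟩ := (hs.prod hK).exists_bound_of_continuousOn
    (hF'.mono (Set.prod_mono_right (Set.subset_univ K)))
  have hF'θ : Continuous (F' θ) :=
    hF'.comp_continuous (f := fun x => (θ, x)) (by fun_prop) fun x => ⟨hθs, trivial⟩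
  refine (hasDerivAt_integral_of_dominated_loc_of_deriv_le hθ (bound := K.indicator fun _ => C)
    ?_ ?_ hF'θ.aestronglyMeasurable ?_ ?_ (Eventually.of_forall fun x t ht => hd t ht x)).2
  · filter_upwards [hθ] with t ht using (hF t ht).aestronglyMeasurable
  · exact (hF θ hθs).integrable_of_hasCompactSupport (.intro hK fun x hx => hFK x hx θ)
  · refine Eventually.of_forall fun x t ht => ?_
    by_cases hx : x ∈ K
    · rw [Set.indicator_of_mem hx]
      exact hC (t, x) ⟨ht, hx⟩
    · simp [hx, hFK' x hx t]
  · exact (integrable_indicator_iff hK.measurableSet).2 (integrableOn_const hK.measure_ne_top)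

theorem mul_norm_integral_mul_le {X 𝕜 : Type*} [MeasurableSpace X] {ν : Measure X} [RCLike 𝕜]
    {κ g : X → 𝕜} {r C : ℝ} (hr : 0 ≤ r) (hg : Integrable g ν)
    (h : ∀ x, g x ≠ 0 → r * ‖κ x‖ ≤ C) :
    r * ‖∫ x, κ x * g x ∂ν‖ ≤ C * ∫ x, ‖g x‖ ∂ν := by
  have hnorm : r * ‖∫ x, κ x * g x ∂ν‖ = ‖∫ x, r • (κ x * g x) ∂ν‖ := by
    rw [integral_smul, norm_smul, Real.norm_of_nonneg hr]
  rw [hnorm, ← integral_const_mul]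
  refine norm_integral_le_of_norm_le (hg.norm.const_mul C) (Eventually.of_forall fun x => ?_)
  rcases eq_or_ne (g x) 0 with hx | hx
  · simp [hx]
  · rw [norm_smul, norm_mul, ← mul_assoc, Real.norm_of_nonneg hr]
    gcongr
    exact h x hx

end ParametricIntegral

section WickRotatable

variable {n : ℕ}

/-- Kernels `k ε` on complexified tuples which are analytic along the Wick rotation by the angles
`θ ∈ [0, π / 4]` and, away from the diagonals, converge as `ε → 0+` for `θ > 0` and are bounded by
a power of `1 / θ`, locally uniformly and uniformly in `ε`. -/
structure IsWickRotatable (k : ℝ → (Fin n → ℂ × ℂ) → ℂ) : Prop where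
  analyticAt : ∀ ε > 0, ∀ θ ∈ Set.Icc 0 (Real.pi / 4), ∀ x, AnalyticAt ℂ (k ε) (wickTuple θ x)
  bound : ∀ K : Set (Fin n → Mink), IsCompact K → K ⊆ offDiag n → ∃ (M : ℕ) (C : ℝ),
    ∀ ε ∈ Set.Ioc (0 : ℝ) 1, ∀ θ ∈ Set.Ioc 0 (Real.pi / 4), ∀ x ∈ K,
      θ ^ M * ‖k ε (wickTuple θ x)‖ ≤ C
  tendsto : ∀ θ ∈ Set.Ioc 0 (Real.pi / 4), ∀ x ∈ offDiag n,
    ∃ c, Tendsto (fun ε => k ε (wickTuple θ x)) (𝓝[>] 0) (𝓝 c)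

namespace IsWickRotatable

variable {k k' : ℝ → (Fin n → ℂ × ℂ) → ℂ}

theorem const (c : ℂ) : IsWickRotatable fun (_ : ℝ) (_ : Fin n → ℂ × ℂ) => c where
  analyticAt _ _ _ _ _ := analyticAt_const
  bound _ _ _ := ⟨0, ‖c‖, fun _ _ _ _ _ _ => by simp⟩
  tendsto _ _ _ _ := ⟨c, tendsto_const_nhds⟩

theorem mul (hk : IsWickRotatable k) (hk' : IsWickRotatable k') :
    IsWickRotatable fun ε z => k ε z * k' ε z where
  analyticAt ε hε θ hθ x := (hk.analyticAt ε hε θ hθ x).mul (hk'.analyticAt ε hε θ hθ x)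
  bound K hK hKs := by
    obtain ⟨M, C, hC⟩ := hk.bound K hK hKs
    obtain ⟨M', C', hC'⟩ := hk'.bound K hK hKs
    refine ⟨M + M', C * C', fun ε hε θ hθ x hx => ?_⟩
    have h := hC ε hε θ hθ x hx
    have hθ0 := hθ.1
    rw [pow_add, norm_mul, mul_mul_mul_comm]
    exact mul_le_mul h (hC' ε hε θ hθ x hx) (by positivity) (le_trans (by positivity) h)
  tendsto θ hθ x hx := by
    obtain ⟨c, hc⟩ := hk.tendsto θ hθ x hx
    obtain ⟨c', hc'⟩ := hk'.tendsto θ hθ x hx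
    exact ⟨_, hc.mul hc'⟩

theorem add (hk : IsWickRotatable k) (hk' : IsWickRotatable k') :
    IsWickRotatable fun ε z => k ε z + k' ε z where
  analyticAt ε hε θ hθ x := (hk.analyticAt ε hε θ hθ x).add (hk'.analyticAt ε hε θ hθ x)
  bound K hK hKs := by
    obtain ⟨M, C, hC⟩ := hk.bound K hK hKs
    obtain ⟨M', C', hC'⟩ := hk'.bound K hK hKs
    refine ⟨M + M', C + C', fun ε hε θ hθ x hx => ?_⟩
    have hθ0 := hθ.1
    have hθ1 : θ ≤ 1 := hθ.2.trans (by linarith [Real.pi_le_four])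
    calc θ ^ (M + M') * ‖k ε (wickTuple θ x) + k' ε (wickTuple θ x)‖
        ≤ θ ^ (M + M') * (‖k ε (wickTuple θ x)‖ + ‖k' ε (wickTuple θ x)‖) := by
          gcongr
          exact norm_add_le _ _
      _ = θ ^ (M + M') * ‖k ε (wickTuple θ x)‖ + θ ^ (M + M') * ‖k' ε (wickTuple θ x)‖ :=
          mul_add _ _ _
      _ ≤ θ ^ M * ‖k ε (wickTuple θ x)‖ + θ ^ M' * ‖k' ε (wickTuple θ x)‖ := by
          gcongr ?_ * _ + ?_ * _
          · exact pow_le_pow_of_le_one hθ0.le hθ1 (Nat.le_add_right _ _)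
          · exact pow_le_pow_of_le_one hθ0.le hθ1 (Nat.le_add_left _ _)
      _ ≤ C + C' := add_le_add (hC ε hε θ hθ x hx) (hC' ε hε θ hθ x hx)
  tendsto θ hθ x hx := by
    obtain ⟨c, hc⟩ := hk.tendsto θ hθ x hx
    obtain ⟨c', hc'⟩ := hk'.tendsto θ hθ x hx
    exact ⟨_, hc.add hc'⟩

theorem sum {ι : Type*} (s : Finset ι) {k : ι → ℝ → (Fin n → ℂ × ℂ) → ℂ}
    (hk : ∀ i ∈ s, IsWickRotatable (k i)) : IsWickRotatable fun ε z => ∑ i ∈ s, k i ε z := by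
  classical
  induction s using Finset.induction_on with
  | empty => simpa using const 0
  | insert i s hi ih =>
    simp_rw [Finset.sum_insert hi]
    exact (hk i (Finset.mem_insert_self i s)).add
      (ih fun j hj => hk j (Finset.mem_insert_of_mem hj))

theorem prod {ι : Type*} (s : Finset ι) {k : ι → ℝ → (Fin n → ℂ × ℂ) → ℂ}
    (hk : ∀ i ∈ s, IsWickRotatable (k i)) : IsWickRotatable fun ε z => ∏ i ∈ s, k i ε z := by
  classical
  induction s using Finset.induction_on with
  | empty => simpa using const 1
  | insert i s hi ih =>
    simp_rw [Finset.prod_insert hi]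
    exact (hk i (Finset.mem_insert_self i s)).mul
      (ih fun j hj => hk j (Finset.mem_insert_of_mem hj))

theorem pow (hk : IsWickRotatable k) (m : ℕ) : IsWickRotatable fun ε z => k ε z ^ m := by
  simpa using prod (Finset.range m) (k := fun _ => k) fun _ _ => hk

section Regularised

variable {ε : ℝ}

theorem contDiff (hk : IsWickRotatable k) (hε : 0 < ε) {θ : ℝ}
    (hθ : θ ∈ Set.Icc 0 (Real.pi / 4)) : ContDiff ℝ 1 fun x => k ε (wickTuple θ x) :=
  contDiff_iff_contDiffAt.2 fun x =>
    ((hk.analyticAt ε hε θ hθ x).restrictScalars (𝕜 := ℝ)).contDiffAt.comp x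
      (wickTuple θ).contDiff.contDiffAt

theorem fderiv_boost (hk : IsWickRotatable k) (hε : 0 < ε) {θ : ℝ}
    (hθ : θ ∈ Set.Icc 0 (Real.pi / 4)) (x : Fin n → Mink) :
    fderiv ℝ (fun x => k ε (wickTuple θ x)) x (boost x) =
      fderiv ℂ (k ε) (wickTuple θ x) (wickTuple θ (boost x)) := by
  have h := (hk.analyticAt ε hε θ hθ x).differentiableAt.hasFDerivAt.restrictScalars ℝ
  exact congrArg (· (boost x)) (h.comp x (wickTuple θ).hasFDerivAt).fderiv

theorem hasDerivAt_angle (hk : IsWickRotatable k) (hε : 0 < ε) {θ : ℝ}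
    (hθ : θ ∈ Set.Icc 0 (Real.pi / 4)) (x : Fin n → Mink) :
    HasDerivAt (fun t => k ε (wickTuple t x))
      (Complex.I * fderiv ℂ (k ε) (wickTuple θ x) (wickTuple θ (boost x))) θ := by
  have h := (hk.analyticAt ε hε θ hθ x).differentiableAt.hasFDerivAt.restrictScalars ℝ
  refine (h.comp_hasDerivAt θ (hasDerivAt_wickTuple θ x)).congr_deriv ?_
  simp

theorem continuousOn_uncurry (hk : IsWickRotatable k) (hε : 0 < ε) :
    ContinuousOn (fun p : ℝ × (Fin n → Mink) => k ε (wickTuple p.1 p.2))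
      (Set.Icc 0 (Real.pi / 4) ×ˢ Set.univ) := fun p hp =>
  ((hk.analyticAt ε hε p.1 hp.1 p.2).continuousAt.tendsto.comp
    (continuous_wickTuple_uncurry.tendsto p)).mono_left nhdsWithin_le_nhds

theorem continuousOn_fderiv_uncurry (hk : IsWickRotatable k) (hε : 0 < ε) :
    ContinuousOn (fun p : ℝ × (Fin n → Mink) =>
        fderiv ℂ (k ε) (wickTuple p.1 p.2) (wickTuple p.1 (boost p.2)))
      (Set.Icc 0 (Real.pi / 4) ×ˢ Set.univ) := fun p hp => by
  have hdir : Continuous fun p : ℝ × (Fin n → Mink) => wickTuple p.1 (boost p.2) :=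
    continuous_wickTuple_uncurry.comp
      (continuous_fst.prodMk (boost.continuous.comp continuous_snd))
  have hfderiv : ContinuousAt (fun p : ℝ × (Fin n → Mink) =>
      fderiv ℂ (k ε) (wickTuple p.1 p.2)) p :=
    (hk.analyticAt ε hε p.1 hp.1 p.2).fderiv.continuousAt.tendsto.comp
      (continuous_wickTuple_uncurry.tendsto p)
  exact (hfderiv.clm_apply hdir.continuousAt).continuousWithinAt

end Regularised

end IsWickRotatable

theorem tsupport_fderiv_boost_subset (g : (Fin n → Mink) → ℂ) :
    tsupport (fun x => fderiv ℝ g x (boost x)) ⊆ tsupport g :=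
  (closure_mono (Function.support_subset_iff'.2 fun x hx => by
    simp [Function.notMem_support.1 hx])).trans (tsupport_fderiv_subset ℝ)

/-- The derivative of a test function along the boosts. -/
def boostDeriv (g : 𝓓(offDiag n, ℂ)) : 𝓓(offDiag n, ℂ) where
  toFun x := fderiv ℝ g x (boost x)
  contDiff' := (g.contDiff.fderiv_right le_rfl).clm_apply boost.contDiff
  hasCompactSupport' := g.hasCompactSupport.of_isClosed_subset (isClosed_tsupport _)
    (tsupport_fderiv_boost_subset g)
  tsupport_subset' := (tsupport_fderiv_boost_subset g).trans g.tsupport_subset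

theorem tsupport_boostDeriv_iterate_subset (g : 𝓓(offDiag n, ℂ)) (m : ℕ) :
    tsupport (boostDeriv^[m] g) ⊆ tsupport g := by
  induction m with
  | zero => exact subset_rfl
  | succ m ih =>
    rw [Function.iterate_succ_apply']
    exact (tsupport_fderiv_boost_subset _).trans ih

namespace IsWickRotatable

variable {k : ℝ → (Fin n → ℂ × ℂ) → ℂ}

theorem hasDerivAt_integral (hk : IsWickRotatable k) {ε : ℝ} (hε : 0 < ε) {θ : ℝ}
    (hθ : θ ∈ Set.Ioo 0 (Real.pi / 4)) (g : 𝓓(offDiag n, ℂ)) :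
    HasDerivAt (fun t => ∫ x, k ε (wickTuple t x) * g x)
      (-Complex.I * ∫ x, k ε (wickTuple θ x) * boostDeriv g x) θ := by
  have hθ' := Set.Ioo_subset_Icc_self hθ
  have hg {x} (hx : x ∉ tsupport g) : g x = 0 := image_eq_zero_of_notMem_tsupport hx
  have hparts : ∫ x, fderiv ℂ (k ε) (wickTuple θ x) (wickTuple θ (boost x)) * g x =
      -∫ x, k ε (wickTuple θ x) * boostDeriv g x := by
    simp_rw [← hk.fderiv_boost hε hθ']
    exact integral_fderiv_clm_mul_of_trace_eq_zero volume trace_boost (hk.contDiff hε hθ')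
      (g.contDiff.of_le (by simp)) g.hasCompactSupport
  have key := hasDerivAt_integral_of_compact_support (ν := volume) (θ := θ)
    (F := fun t x => k ε (wickTuple t x) * g x)
    (F' := fun t x => Complex.I * fderiv ℂ (k ε) (wickTuple t x) (wickTuple t (boost x)) * g x)
    g.hasCompactSupport isCompact_Icc (Icc_mem_nhds hθ.1 hθ.2)
    (fun t ht => (hk.contDiff hε ht).continuous.mul g.continuous)
    ((continuousOn_const.mul (hk.continuousOn_fderiv_uncurry hε)).mul
      (g.continuous.comp continuous_snd).continuousOn)
    (fun t ht x => (hk.hasDerivAt_angle hε ht x).mul_const _)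
    (fun x hx t => by simp [hg hx]) (fun x hx t => by simp [hg hx])
  refine key.congr_deriv ?_
  simp_rw [mul_assoc]
  rw [integral_const_mul, hparts, mul_neg, neg_mul]

theorem continuousOn_integral (hk : IsWickRotatable k) {ε : ℝ} (hε : 0 < ε)
    (g : 𝓓(offDiag n, ℂ)) :
    ContinuousOn (fun t => ∫ x, k ε (wickTuple t x) * g x) (Set.Icc 0 (Real.pi / 4)) :=
  continuousOn_integral_of_compact_support g.hasCompactSupport
    ((hk.continuousOn_uncurry hε).mul (g.continuous.comp continuous_snd).continuousOn)
    fun t x _ hx => by simp [image_eq_zero_of_notMem_tsupport hx]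

theorem tendsto_integral_of_pos (hk : IsWickRotatable k) {θ : ℝ}
    (hθ : θ ∈ Set.Ioc 0 (Real.pi / 4)) (g : 𝓓(offDiag n, ℂ)) :
    ∃ c, Tendsto (fun ε => ∫ x, k ε (wickTuple θ x) * g x) (𝓝[>] 0) (𝓝 c) := by
  obtain ⟨M, C, hC⟩ := hk.bound _ g.hasCompactSupport g.tsupport_subset
  have hlim (x) : ∃ c, Tendsto (fun ε => k ε (wickTuple θ x) * g x) (𝓝[>] 0) (𝓝 c) := by
    by_cases hx : x ∈ tsupport g
    · obtain ⟨c, hc⟩ := hk.tendsto θ hθ x (g.tsupport_subset hx)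
      exact ⟨c * g x, hc.mul_const _⟩
    · exact ⟨0, by simp [image_eq_zero_of_notMem_tsupport hx]⟩
  choose c hc using hlim
  refine ⟨∫ x, c x, tendsto_integral_filter_of_dominated_convergence
    (fun x => C / θ ^ M * ‖g x‖) ?_ ?_ ?_ (Eventually.of_forall hc)⟩
  · filter_upwards [self_mem_nhdsWithin] with ε hε
    exact ((hk.contDiff hε ⟨hθ.1.le, hθ.2⟩).continuous.mul g.continuous).aestronglyMeasurable
  · filter_upwards [Ioc_mem_nhdsGT (one_pos (α := ℝ))] with ε hε
    refine Eventually.of_forall fun x => ?_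
    by_cases hx : x ∈ tsupport g
    · rw [norm_mul]
      gcongr
      rw [le_div_iff₀ (pow_pos hθ.1 M), mul_comm]
      exact hC ε hε θ hθ x hx
    · simp [image_eq_zero_of_notMem_tsupport hx]
  · exact (g.continuous.integrable_of_hasCompactSupport g.hasCompactSupport).norm.const_mul _

theorem exists_tendsto_integral (hk : IsWickRotatable k) (g : 𝓓(offDiag n, ℂ)) :
    ∃ c, Tendsto (fun ε => ∫ x, k ε (wickTuple 0 x) * g x) (𝓝[>] 0) (𝓝 c) := by
  obtain ⟨M, C, hC⟩ := hk.bound _ g.hasCompactSupport g.tsupport_subset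
  let Ψ (ε : ℝ) (m : ℕ) (θ : ℝ) : ℂ :=
    (-Complex.I) ^ m * ∫ x, k ε (wickTuple θ x) * (boostDeriv^[m] g) x
  have hbound : ∀ ε ∈ Set.Ioc (0 : ℝ) 1, ∀ m, ∀ θ ∈ Set.Ioc 0 (Real.pi / 4),
      (θ - 0) ^ M * ‖Ψ ε m θ‖ ≤ C * ∫ x, ‖(boostDeriv^[m] g) x‖ := by
    intro ε hε m θ hθ
    have hsupp (x : Fin n → Mink) (hx : (boostDeriv^[m] g) x ≠ 0) : x ∈ tsupport g :=
      tsupport_boostDeriv_iterate_subset g m (subset_tsupport _ hx)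
    simpa [Ψ] using mul_norm_integral_mul_le (pow_pos hθ.1 M).le
      ((boostDeriv^[m] g).continuous.integrable_of_hasCompactSupport
        (boostDeriv^[m] g).hasCompactSupport) fun x hx => hC ε hε θ hθ x (hsupp x hx)
  have key := exists_tendsto_endpoint_of_pow_mul_norm_le (l := 𝓝[>] (0 : ℝ)) (a := 0)
    (b := Real.pi / 4) (by positivity) (Ψ := Ψ) (M := M)
    (B := fun m => C * ∫ x, ‖(boostDeriv^[m] g) x‖) ?_ ?_ ?_ ?_
  · simpa [Ψ] using key
  · filter_upwards [self_mem_nhdsWithin] with ε hε m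
    exact continuousOn_const.mul (hk.continuousOn_integral hε _)
  · filter_upwards [self_mem_nhdsWithin] with ε hε m θ hθ
    refine ((hk.hasDerivAt_integral hε hθ (boostDeriv^[m] g)).const_mul _).congr_deriv ?_
    simp only [Ψ, Function.iterate_succ_apply', pow_succ, mul_assoc]
  · filter_upwards [Ioc_mem_nhdsGT (one_pos (α := ℝ))] using hbound
  · intro m θ hθ
    obtain ⟨c, hc⟩ := hk.tendsto_integral_of_pos hθ (boostDeriv^[m] g)
    exact ⟨_, hc.const_mul _⟩

theorem exists_isContinuousBoundaryValue (hk : IsWickRotatable k) {b : (Fin n → Mink) → ℂ}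
    (hb : ContDiff ℝ ∞ b) :
    ∃ u, IsContinuousBoundaryValue (fun ε x => b x * k ε (wickTuple 0 x)) u := by
  refine exists_isContinuousBoundaryValue_of_tendsto (fun ε hε => hb.continuous.mul
    (hk.contDiff hε ⟨le_rfl, by positivity⟩).continuous) fun f => ?_
  let g : 𝓓(offDiag n, ℂ) :=
    { toFun := fun x => b x * (f x : ℂ)
      contDiff' := hb.mul (Complex.ofRealCLM.contDiff.comp f.contDiff)
      hasCompactSupport' := (f.hasCompactSupport.comp_left Complex.ofReal_zero).mul_left
      tsupport_subset' := tsupport_mul_subset_right.trans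
        ((tsupport_comp_subset Complex.ofReal_zero f).trans f.tsupport_subset) }
  refine (hk.exists_tendsto_integral g).imp fun c hc => hc.congr fun ε => ?_
  refine integral_congr_ae (Eventually.of_forall fun x => ?_)
  change k ε (wickTuple 0 x) * (b x * (f x : ℂ)) = _
  ring

end IsWickRotatable

end WickRotatable

section Propagator

/-- The regularised Minkowski square `x² + iε` at complex arguments. -/
def regSq (ε : ℝ) (z : ℂ × ℂ) : ℂ := 4 * z.1 * z.2 + (ε : ℂ) * Complex.I

/-- The `m`-th `ξ`-derivative of the regularised Feynman propagator at complex arguments. -/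
def propDeriv (μ : ℝ) (m : ℕ) (ε : ℝ) (z : ℂ × ℂ) : ℂ :=
  -(1 / (4 * (Real.pi : ℂ))) *
    match m with
    | 0 => Complex.log ((μ : ℂ) ^ 2 * regSq ε z)
    | m + 1 => (-1) ^ m * (m.factorial : ℂ) * ((4 * z.1) ^ (m + 1) / regSq ε z ^ (m + 1))

/-- A point of the Minkowski plane as a point of its complexification. -/
def complexify (x : Mink) : ℂ × ℂ := (x.1, x.2)

theorem continuous_complexify : Continuous complexify := by
  unfold complexify
  fun_prop

theorem wickCLM_zero (x : Mink) : wickCLM 0 x = complexify x := by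
  simp [wickCLM_apply, complexify]

theorem feynman_eq_propDeriv (μ ε : ℝ) (x : Mink) :
    feynman μ ε x = propDeriv μ 0 ε (complexify x) := by
  simp [feynman, propDeriv, regSq, complexify, minkSq]

theorem regSq_complexify_im (ε : ℝ) (x : Mink) : (regSq ε (complexify x)).im = ε := by
  simp [regSq, complexify]

theorem continuous_regSq_uncurry : Continuous fun p : ℝ × ℂ × ℂ => regSq p.1 p.2 := by
  unfold regSq
  fun_prop

theorem ne_zero_of_im_pos {w : ℂ} (hw : 0 < w.im) : w ≠ 0 :=
  fun h => hw.ne' (by rw [h, Complex.zero_im])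

variable {μ : ℝ}

theorem sq_mul_mem_slitPlane (hμ : μ ≠ 0) {w : ℂ} (hw : 0 < w.im) :
    (μ : ℂ) ^ 2 * w ∈ Complex.slitPlane := by
  refine Or.inr ?_
  rw [← Complex.ofReal_pow, Complex.im_ofReal_mul]
  positivity

theorem analyticAt_propDeriv (hμ : μ ≠ 0) (m : ℕ) {ε : ℝ} {z : ℂ × ℂ} (hz : 0 < (regSq ε z).im) :
    AnalyticAt ℂ (propDeriv μ m ε) z := by
  have hreg : AnalyticAt ℂ (regSq ε) z :=
    ((analyticAt_const.mul analyticAt_fst).mul analyticAt_snd).add analyticAt_const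
  cases m with
  | zero =>
    exact analyticAt_const.mul ((analyticAt_const.mul hreg).clog (sq_mul_mem_slitPlane hμ hz))
  | succ m =>
    exact analyticAt_const.mul (analyticAt_const.mul (((analyticAt_const.mul analyticAt_fst).pow
      _).div (hreg.pow _) (pow_ne_zero _ (ne_zero_of_im_pos hz))))

theorem continuousAt_propDeriv_regularization (hμ : μ ≠ 0) (m : ℕ) {ε : ℝ} {z : ℂ × ℂ}
    (hz : 0 < (regSq ε z).im) : ContinuousAt (fun ε => propDeriv μ m ε z) ε := by
  have hreg : ContinuousAt (fun ε => regSq ε z) ε :=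
    (continuous_regSq_uncurry.comp (Continuous.prodMk_left z)).continuousAt
  cases m with
  | zero =>
    exact continuousAt_const.mul ((continuousAt_const.mul hreg).clog (sq_mul_mem_slitPlane hμ hz))
  | succ m =>
    exact continuousAt_const.mul (continuousAt_const.mul (continuousAt_const.div
      (hreg.pow _) (pow_ne_zero _ (ne_zero_of_im_pos hz))))

theorem continuous_propDeriv (hμ : μ ≠ 0) (m : ℕ) {ε : ℝ} (hε : 0 < ε) :
    Continuous fun x : Mink => propDeriv μ m ε (complexify x) :=
  continuous_iff_continuousAt.2 fun x =>
    ((analyticAt_propDeriv hμ m (by rwa [regSq_complexify_im])).continuousAt).comp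
      continuous_complexify.continuousAt

theorem hasDerivAt_propDeriv (hμ : μ ≠ 0) (m : ℕ) {ε : ℝ} (hε : 0 < ε) (x : Mink) :
    HasDerivAt (fun s : ℝ => propDeriv μ m ε (complexify (x.1, s)))
      (propDeriv μ (m + 1) ε (complexify x)) x.2 := by
  have hreg : HasDerivAt (fun s : ℝ => regSq ε (complexify (x.1, s))) (4 * (x.1 : ℂ)) x.2 := by
    simpa [regSq, complexify] using ((hasDerivAt_id x.2).ofReal_comp.const_mul
      (4 * (x.1 : ℂ))).add_const ((ε : ℂ) * Complex.I)
  have him : 0 < (regSq ε (complexify x)).im := by rwa [regSq_complexify_im]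
  have hne : regSq ε (x.1, x.2) ≠ 0 := ne_zero_of_im_pos him
  cases m with
  | zero =>
    have hμ' : (μ : ℂ) ≠ 0 := by exact_mod_cast hμ
    refine (((hreg.const_mul ((μ : ℂ) ^ 2)).clog_real (sq_mul_mem_slitPlane hμ him)).const_mul
      (-(1 / (4 * (Real.pi : ℂ))))).congr_deriv ?_
    simp only [propDeriv, complexify, zero_add, pow_zero, pow_one, Nat.factorial_zero, Nat.cast_one]
    field_simp
  | succ m =>
    have hpow : HasDerivAt (fun s : ℝ => (regSq ε (complexify (x.1, s)) ^ (m + 1))⁻¹)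
        (-(((m + 1 : ℕ) : ℂ) * regSq ε (complexify x) ^ m * (4 * (x.1 : ℂ))) /
          (regSq ε (complexify x) ^ (m + 1)) ^ 2) x.2 :=
      (hreg.pow (m + 1)).inv (pow_ne_zero _ hne)
    refine (((hpow.const_mul ((4 * (x.1 : ℂ)) ^ (m + 1))).const_mul
      ((-1) ^ m * (m.factorial : ℂ))).const_mul (-(1 / (4 * (Real.pi : ℂ))))).congr_deriv ?_
    simp only [propDeriv, complexify, Nat.factorial_succ, Nat.cast_mul]
    field_simp
    ring

theorem regSq_wickCLM_im (ε θ : ℝ) (x : Mink) :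
    (regSq ε (wickCLM θ x)).im = 4 * Real.cos θ * Real.sin θ * (x.1 ^ 2 + x.2 ^ 2) + ε := by
  simp only [regSq, wickCLM_apply, Complex.add_im, Complex.mul_im, Complex.add_re, Complex.mul_re,
    Complex.I_re, Complex.I_im, Complex.ofReal_re, Complex.ofReal_im, Complex.re_ofNat,
    Complex.im_ofNat]
  ring

theorem le_four_mul_cos_mul_sin {θ : ℝ} (hθ : θ ∈ Set.Icc 0 (Real.pi / 4)) :
    θ ≤ 4 * Real.cos θ * Real.sin θ := by
  have h := Real.mul_le_sin (x := 2 * θ) (by linarith [hθ.1]) (by linarith [hθ.2])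
  have hpi : 1 / 2 ≤ 2 / Real.pi := by
    rw [div_le_div_iff₀ two_pos Real.pi_pos]
    linarith [Real.pi_le_four]
  rw [Real.sin_two_mul] at h
  nlinarith [hθ.1]

theorem add_le_regSq_wickCLM_im (ε : ℝ) {θ : ℝ} (hθ : θ ∈ Set.Icc 0 (Real.pi / 4)) (x : Mink) :
    θ * (x.1 ^ 2 + x.2 ^ 2) + ε ≤ (regSq ε (wickCLM θ x)).im := by
  rw [regSq_wickCLM_im]
  gcongr
  exact le_four_mul_cos_mul_sin hθ

theorem regSq_wickCLM_im_pos {ε θ : ℝ} (hε : 0 < ε) (hθ : θ ∈ Set.Icc 0 (Real.pi / 4)) (x : Mink) :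
    0 < (regSq ε (wickCLM θ x)).im := by
  have := mul_nonneg hθ.1 (add_nonneg (sq_nonneg x.1) (sq_nonneg x.2))
  linarith [add_le_regSq_wickCLM_im ε hθ x]

theorem sq_add_sq_pos {x : Mink} (hx : x ≠ 0) : 0 < x.1 ^ 2 + x.2 ^ 2 := by
  rcases Prod.mk_eq_zero.not.1 hx |> not_and_or.1 with h | h <;> positivity

theorem norm_log_le {w : ℂ} (hw : w ≠ 0) : ‖Complex.log w‖ ≤ ‖w‖ + ‖w‖⁻¹ + Real.pi := by
  have hpos : 0 < ‖w‖ := norm_pos_iff.2 hw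
  have hlog := Real.log_le_sub_one_of_pos hpos
  have hlog_inv := Real.log_le_sub_one_of_pos (inv_pos.2 hpos)
  rw [Real.log_inv] at hlog_inv
  refine (Complex.norm_le_abs_re_add_abs_im _).trans (add_le_add ?_ ?_)
  · rw [Complex.log_re, abs_le]
    constructor <;> linarith [inv_pos.2 hpos]
  · rw [Complex.log_im]
    exact Complex.abs_arg_le_pi w

theorem norm_neg_inv_four_pi_mul_le (w : ℂ) : ‖-(1 / (4 * (Real.pi : ℂ))) * w‖ ≤ ‖w‖ := by
  rw [norm_mul]
  refine mul_le_of_le_one_left (norm_nonneg _) ?_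
  rw [norm_neg, norm_div, norm_mul, Complex.norm_real, Real.norm_of_nonneg Real.pi_pos.le,
    norm_one, Complex.norm_ofNat, div_le_one (by positivity)]
  linarith [Real.pi_gt_three]

theorem norm_propDeriv_zero_le (hμ : μ ≠ 0) {ε : ℝ} {z : ℂ × ℂ} (hz : regSq ε z ≠ 0) :
    ‖propDeriv μ 0 ε z‖ ≤ μ ^ 2 * ‖regSq ε z‖ + (μ ^ 2 * ‖regSq ε z‖)⁻¹ + Real.pi := by
  have hμ' : (μ : ℂ) ≠ 0 := by exact_mod_cast hμ
  have h := norm_log_le (mul_ne_zero (pow_ne_zero 2 hμ') hz)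
  rw [norm_mul, norm_pow, Complex.norm_real, Real.norm_eq_abs, sq_abs] at h
  exact (norm_neg_inv_four_pi_mul_le _).trans h

theorem norm_propDeriv_succ_le (μ : ℝ) (m : ℕ) (ε : ℝ) (z : ℂ × ℂ) :
    ‖propDeriv μ (m + 1) ε z‖ ≤ m.factorial * (‖4 * z.1‖ / ‖regSq ε z‖) ^ (m + 1) := by
  refine (norm_neg_inv_four_pi_mul_le _).trans_eq ?_
  simp [div_pow]

/-- The Wick rotation moves `x² + i0` away from zero by at least `θ (τ² + ξ²)`. -/
theorem exists_wickCLM_bounds {L : Set Mink} (hL : IsCompact L) (h0 : (0 : Mink) ∉ L) :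
    ∃ C, ∀ ε ∈ Set.Ioc (0 : ℝ) 1, ∀ θ ∈ Set.Ioc 0 (Real.pi / 4), ∀ x ∈ L,
      θ / ‖regSq ε (wickCLM θ x)‖ ≤ C ∧ ‖regSq ε (wickCLM θ x)‖ ≤ C ∧
        ‖4 * (wickCLM θ x).1‖ ≤ C := by
  obtain ⟨δ, hδ, hδL⟩ := hL.exists_forall_le' (f := fun x : Mink => x.1 ^ 2 + x.2 ^ 2)
    (by fun_prop) fun x hx => sq_add_sq_pos (ne_of_mem_of_not_mem hx h0)
  have hcompact := (isCompact_Icc (a := (0 : ℝ)) (b := 1)).prod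
    ((isCompact_Icc (a := (0 : ℝ)) (b := Real.pi / 4)).prod hL)
  have hwick : Continuous fun p : ℝ × ℝ × Mink => wickCLM p.2.1 p.2.2 := by
    simp only [wickCLM_apply]
    fun_prop
  have hupper : Continuous fun p : ℝ × ℝ × Mink =>
      (regSq p.1 (wickCLM p.2.1 p.2.2), 4 * (wickCLM p.2.1 p.2.2).1) :=
    (continuous_regSq_uncurry.comp (continuous_fst.prodMk hwick)).prodMk
      (continuous_const.mul hwick.fst)
  obtain ⟨R, hR⟩ := hcompact.exists_bound_of_continuousOn hupper.continuousOn
  refine ⟨max (1 / δ) R, fun ε hε θ hθ x hx => ⟨le_max_of_le_left ?_, ?_⟩⟩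
  · have hlower : θ * δ ≤ ‖regSq ε (wickCLM θ x)‖ :=
      calc θ * δ ≤ θ * (x.1 ^ 2 + x.2 ^ 2) := mul_le_mul_of_nonneg_left (hδL x hx) hθ.1.le
        _ ≤ (regSq ε (wickCLM θ x)).im := by
          linarith [hε.1, add_le_regSq_wickCLM_im ε (Set.Ioc_subset_Icc_self hθ) x]
        _ ≤ _ := (le_abs_self _).trans (Complex.abs_im_le_norm _)
    rw [div_le_div_iff₀ ((mul_pos hθ.1 hδ).trans_le hlower) hδ]
    linarith
  · have h := hR (ε, θ, x) ⟨Set.Ioc_subset_Icc_self hε, Set.Ioc_subset_Icc_self hθ, hx⟩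
    exact (max_le_iff.1 h).imp (le_max_of_le_right ·) (le_max_of_le_right ·)

theorem exists_pow_mul_norm_propDeriv_le (hμ : μ ≠ 0) (m : ℕ) {L : Set Mink} (hL : IsCompact L)
    (h0 : (0 : Mink) ∉ L) : ∃ C, ∀ ε ∈ Set.Ioc (0 : ℝ) 1, ∀ θ ∈ Set.Ioc 0 (Real.pi / 4), ∀ x ∈ L,
      θ ^ (m + 1) * ‖propDeriv μ m ε (wickCLM θ x)‖ ≤ C := by
  obtain ⟨C, hC⟩ := exists_wickCLM_bounds hL h0
  have hle_one {θ : ℝ} (hθ : θ ∈ Set.Ioc 0 (Real.pi / 4)) : θ ≤ 1 :=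
    hθ.2.trans (by linarith [Real.pi_le_four])
  cases m with
  | zero =>
    refine ⟨1 * (μ ^ 2 * C) + (μ ^ 2)⁻¹ * C + 1 * Real.pi, fun ε hε θ hθ x hx => ?_⟩
    obtain ⟨hdiv, hreg, -⟩ := hC ε hε θ hθ x hx
    have hθ0 := hθ.1
    have hθ1 := hle_one hθ
    have hne : regSq ε (wickCLM θ x) ≠ 0 := ne_zero_of_im_pos
      (regSq_wickCLM_im_pos hε.1 (Set.Ioc_subset_Icc_self hθ) x)
    calc θ ^ (0 + 1) * ‖propDeriv μ 0 ε (wickCLM θ x)‖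
        ≤ θ * (μ ^ 2 * ‖regSq ε (wickCLM θ x)‖ + (μ ^ 2 * ‖regSq ε (wickCLM θ x)‖)⁻¹ +
            Real.pi) := by
          rw [zero_add, pow_one]
          gcongr
          exact norm_propDeriv_zero_le hμ hne
      _ = θ * (μ ^ 2 * ‖regSq ε (wickCLM θ x)‖) + (μ ^ 2)⁻¹ * (θ / ‖regSq ε (wickCLM θ x)‖) +
            θ * Real.pi := by ring
      _ ≤ _ := by gcongr
  | succ m =>
    refine ⟨1 * m.factorial * (C * C) ^ (m + 1), fun ε hε θ hθ x hx => ?_⟩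
    obtain ⟨hdiv, -, hnum⟩ := hC ε hε θ hθ x hx
    have hθ0 := hθ.1
    have hθ1 := hle_one hθ
    have hC0 : 0 ≤ C := (norm_nonneg _).trans hnum
    calc θ ^ (m + 1 + 1) * ‖propDeriv μ (m + 1) ε (wickCLM θ x)‖
        ≤ θ ^ (m + 1 + 1) * (m.factorial *
            (‖4 * (wickCLM θ x).1‖ / ‖regSq ε (wickCLM θ x)‖) ^ (m + 1)) := by
          gcongr
          exact norm_propDeriv_succ_le μ m ε _
      _ = θ * m.factorial *
            (θ / ‖regSq ε (wickCLM θ x)‖ * ‖4 * (wickCLM θ x).1‖) ^ (m + 1) := by ring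
      _ ≤ _ := by gcongr

theorem isWickRotatable_propDeriv (hμ : μ ≠ 0) (m : ℕ) {n : ℕ} {i j : Fin n} (hij : i ≠ j) :
    IsWickRotatable fun ε (z : Fin n → ℂ × ℂ) => propDeriv μ m ε (z i - z j) where
  analyticAt ε hε θ hθ x := by
    let sub : (Fin n → ℂ × ℂ) →L[ℂ] ℂ × ℂ :=
      ContinuousLinearMap.proj (R := ℂ) (φ := fun _ => ℂ × ℂ) i - ContinuousLinearMap.proj j
    refine AnalyticAt.fun_comp (g := propDeriv μ m ε) (f := sub) ?_ (sub.analyticAt _)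
    refine analyticAt_propDeriv hμ m ?_
    simpa [sub] using regSq_wickCLM_im_pos hε hθ (x i - x j)
  bound K hK hKs := by
    obtain ⟨C, hC⟩ := exists_pow_mul_norm_propDeriv_le hμ m
      (hK.image (f := fun x => x i - x j) (by fun_prop))
      (by rintro ⟨x, hx, h⟩; exact (hKs hx).ne hij (sub_eq_zero.1 h))
    refine ⟨m + 1, C, fun ε hε θ hθ x hx => ?_⟩
    simpa using hC ε hε θ hθ _ ⟨x, hx, rfl⟩
  tendsto θ hθ x hx := by
    refine ⟨propDeriv μ m 0 (wickCLM θ (x i - x j)), ?_⟩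
    have him := add_le_regSq_wickCLM_im 0 (Set.Ioc_subset_Icc_self hθ) (x i - x j)
    have hpos := mul_pos hθ.1 (sq_add_sq_pos (sub_ne_zero.2 (hx.ne hij)))
    simp only [wickTuple_apply, ← map_sub]
    exact (continuousAt_propDeriv_regularization hμ m (by linarith)).tendsto.mono_left
      nhdsWithin_le_nhds

end Propagator

section Jets

theorem Conf.contDiff (φ : Conf) : ContDiff ℝ ∞ φ.1 := φ.2

theorem hasDerivAt_snd_line {f : Mink → ℝ} {x : Mink} (hf : DifferentiableAt ℝ f x) :
    HasDerivAt (fun s => f (x.1, s)) (fderiv ℝ f x (0, 1)) x.2 :=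
  HasFDerivAt.comp_hasDerivAt (f := fun s : ℝ => ((x.1, s) : Mink)) x.2 hf.hasFDerivAt
    ((hasDerivAt_const _ _).prodMk (hasDerivAt_id _))

theorem dXi_eq_fderiv {f : Mink → ℝ} (hf : Differentiable ℝ f) :
    dXi f = fun x => fderiv ℝ f x (0, 1) :=
  funext fun x => (hasDerivAt_snd_line (hf x)).deriv

theorem hasDerivAt_dXi {f : Mink → ℝ} (hf : Differentiable ℝ f) (x : Mink) :
    HasDerivAt (fun s => f (x.1, s)) (dXi f x) x.2 :=
  (hasDerivAt_snd_line (hf x)).differentiableAt.hasDerivAt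

theorem contDiff_dXi {f : Mink → ℝ} (hf : ContDiff ℝ ∞ f) : ContDiff ℝ ∞ (dXi f) := by
  rw [dXi_eq_fderiv (hf.differentiable (by simp))]
  exact (hf.fderiv_right (m := ∞) (by simp)).clm_apply contDiff_const

theorem dXi_comp_sub (f : Mink → ℝ) (v x : Mink) : dXi (fun y => f (y - v)) x = dXi f (x - v) :=
  deriv_comp_sub_const (fun s => f (x.1 - v.1, s)) v.2 x.2

/-- `∂/∂ξ` as a linear map on configurations. -/
def dXiLin : Conf →ₗ[ℝ] Conf where
  toFun φ := ⟨dXi φ.1, contDiff_dXi φ.contDiff⟩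
  map_add' φ ψ := by
    ext x
    exact ((hasDerivAt_dXi (φ.contDiff.differentiable (by simp)) x).add
      (hasDerivAt_dXi (ψ.contDiff.differentiable (by simp)) x)).deriv
  map_smul' c φ := by
    ext x
    exact ((hasDerivAt_dXi (φ.contDiff.differentiable (by simp)) x).const_smul c).deriv

/-- The `m`-th `ξ`-derivative at the point `x`, as a linear functional of the configuration. -/
def jet (m : ℕ) (x : Mink) : Conf →ₗ[ℝ] ℝ where
  toFun φ := ((dXiLin ^ m) φ).1 x
  map_add' φ ψ := by
    rw [map_add]
    rfl
  map_smul' c φ := by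
    rw [map_smul]
    rfl

theorem jet_zero (x : Mink) (φ : Conf) : jet 0 x φ = φ.1 x := rfl

theorem jet_succ (m : ℕ) (φ : Conf) : (fun x => jet (m + 1) x φ) = dXi fun x => jet m x φ := by
  funext x
  change ((dXiLin ^ (m + 1)) φ).1 x = _
  rw [pow_succ', Module.End.mul_apply]
  rfl

theorem contDiff_jet (m : ℕ) (φ : Conf) : ContDiff ℝ ∞ fun x => jet m x φ :=
  ((dXiLin ^ m) φ).contDiff

theorem jet_deltaApprox (m k : ℕ) (x v : Mink) :
    jet m x (deltaApprox k v) = jet m (x - v) (deltaApprox k 0) := by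
  induction m generalizing x with
  | zero => simp [jet_zero, deltaApprox]
  | succ m ih =>
    rw [congrFun (jet_succ m (deltaApprox k v)) x, congrFun (jet_succ m (deltaApprox k 0)) (x - v)]
    simp_rw [ih]
    exact dXi_comp_sub _ v x

end Jets

section XiTower

/-- A sequence of continuous functions each of which is the `ξ`-derivative of the preceding one. -/
structure IsXiTower (H : ℕ → Mink → ℂ) : Prop where
  continuous : ∀ m, Continuous (H m)
  hasDerivAt : ∀ m x, HasDerivAt (fun s => H m (x.1, s)) (H (m + 1) x) x.2

theorem isXiTower_propDeriv {μ : ℝ} (hμ : μ ≠ 0) {ε : ℝ} (hε : 0 < ε) :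
    IsXiTower fun m x => propDeriv μ m ε (complexify x) where
  continuous m := continuous_propDeriv hμ m hε
  hasDerivAt m x := hasDerivAt_propDeriv hμ m hε x

theorem isXiTower_jet (φ : Conf) : IsXiTower fun m x => (jet m x φ : ℂ) where
  continuous m := Complex.continuous_ofReal.comp (contDiff_jet m φ).continuous
  hasDerivAt m x := by
    rw [congrFun (jet_succ m φ) x]
    exact (hasDerivAt_dXi ((contDiff_jet m φ).differentiable (by simp)) x).ofReal_comp

namespace IsXiTower

variable {H G : ℕ → Mink → ℂ}

theorem hasCompactSupport (hG : IsXiTower G) (hG0 : HasCompactSupport (G 0)) (m : ℕ) :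
    HasCompactSupport (G m) := by
  induction m with
  | zero => exact hG0
  | succ m ih =>
    refine ih.mono' (Function.support_subset_iff'.2 fun x hx => ?_)
    have hline : (fun s => G m (x.1, s)) =ᶠ[𝓝 x.2] fun _ => 0 :=
      (Continuous.prodMk_right x.1).tendsto' x.2 x rfl |>.eventually
        (notMem_tsupport_iff_eventuallyEq.1 hx)
    exact (hG.hasDerivAt m x).unique ((hasDerivAt_const x.2 0).congr_of_eventuallyEq hline)

theorem hasLineDerivAt_comp_sub (hH : IsXiTower H) (m : ℕ) (u v : Mink) :
    HasLineDerivAt ℝ (fun v => H m (u - v)) (-H (m + 1) (u - v)) v ((0, 1) : Mink) := by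
  have hinner : HasDerivAt (fun t : ℝ => (u - v).2 - t) (-1) 0 := by
    simpa using (hasDerivAt_id (0 : ℝ)).const_sub (u - v).2
  have h := HasDerivAt.scomp (h := fun t : ℝ => (u - v).2 - t)
    (g₁ := fun s => H m ((u - v).1, s)) 0 (by simpa using hH.hasDerivAt m (u - v)) hinner
  rw [neg_one_smul] at h
  refine HasDerivAt.congr_of_eventuallyEq h (Eventually.of_forall fun t => congrArg (H m) ?_)
  ext <;> simp [sub_sub]

theorem integrable_mul_comp_sub (hH : IsXiTower H) (hG : IsXiTower G)
    (hG0 : HasCompactSupport (G 0)) (r m : ℕ) (u y : Mink) :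
    Integrable fun v => H r (u - v) * G m (y - v) :=
  (((hH.continuous r).comp (continuous_const.sub continuous_id)).mul
    ((hG.continuous m).comp (continuous_const.sub continuous_id))).integrable_of_hasCompactSupport
      ((hG.hasCompactSupport hG0 m).comp_homeomorph (Homeomorph.subLeft y)).mul_left

theorem integral_mul_comp_sub_succ (hH : IsXiTower H) (hG : IsXiTower G)
    (hG0 : HasCompactSupport (G 0)) (r m : ℕ) (u y : Mink) :
    ∫ v, H r (u - v) * G (m + 1) (y - v) = -∫ v, H (r + 1) (u - v) * G m (y - v) := by
  have hint := hH.integrable_mul_comp_sub hG hG0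
  have h := integral_bilinear_hasLineDerivAt_right_eq_neg_left_of_integrable
    (μ := (volume : Measure Mink)) (B := ContinuousLinearMap.mul ℝ ℂ)
    (by simpa using (hint (r + 1) m u y).neg) (by simpa using (hint r (m + 1) u y).neg)
    (hint r m u y) (fun v _ => hH.hasLineDerivAt_comp_sub r u v)
    (fun v _ => hG.hasLineDerivAt_comp_sub m y v)
  simp only [ContinuousLinearMap.mul_apply', mul_neg, neg_mul, integral_neg, neg_neg] at h
  rw [← h, neg_neg]

theorem integral_mul_comp_sub (hH : IsXiTower H) (hG : IsXiTower G)
    (hG0 : HasCompactSupport (G 0)) (r m : ℕ) (u y : Mink) :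
    ∫ v, H r (u - v) * G m (y - v) = (-1) ^ m * ∫ v, H (r + m) (u - v) * G 0 (y - v) := by
  induction m generalizing r with
  | zero => simp
  | succ m ih =>
    rw [hH.integral_mul_comp_sub_succ hG hG0, ih, add_right_comm, add_assoc]
    ring

end IsXiTower

end XiTower

section Mollification

open scoped Convolution

theorem deltaApprox_apply (k : ℕ) (u y : Mink) :
    (deltaApprox k u).1 y = (bump k).normed volume (y - u) := rfl

theorem hasCompactSupport_deltaApprox (k : ℕ) (u : Mink) :
    HasCompactSupport (deltaApprox k u).1 :=
  (bump k).hasCompactSupport_normed.comp_homeomorph (Homeomorph.subRight u)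

theorem tendsto_bump_rOut : Tendsto (fun k => (bump k).rOut) atTop (𝓝 0) := by
  simpa [bump] using tendsto_one_div_add_atTop_nhds_zero_nat (𝕜 := ℝ)

/-- The convolution with the `k`-th approximation of the Dirac delta. -/
def mollify (k : ℕ) (G : Mink → ℂ) : Mink → ℂ :=
  (bump k).normed volume ⋆[ContinuousLinearMap.lsmul ℝ ℝ, volume] G

theorem continuous_mollify (k : ℕ) {G : Mink → ℂ} (hG : Continuous G) :
    Continuous (mollify k G) :=
  (bump k).hasCompactSupport_normed.continuous_convolution_left _
    ((bump k).contDiff_normed (n := 0)).continuous hG.locallyIntegrable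

theorem integral_deltaApprox_mul (k : ℕ) (G : Mink → ℂ) (x : Mink) :
    ∫ u, ((deltaApprox k u).1 x : ℂ) * G u = mollify k G x := by
  rw [mollify, convolution_def,
    ← integral_sub_left_eq_self (fun u => ((deltaApprox k u).1 x : ℂ) * G u) volume x]
  simp [deltaApprox_apply]

theorem integral_comp_sub_mul_deltaApprox (k : ℕ) (G : Mink → ℂ) (u y : Mink) :
    ∫ v, G (u - v) * ((deltaApprox k v).1 y : ℂ) = mollify k G (u - y) := by
  rw [← integral_deltaApprox_mul,
    ← integral_sub_left_eq_self (fun v => ((deltaApprox k v).1 (u - y) : ℂ) * G v) volume u]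
  refine integral_congr_ae (Eventually.of_forall fun v => ?_)
  have heven : (deltaApprox k (u - v)).1 (u - y) = (deltaApprox k v).1 y := by
    rw [deltaApprox_apply, deltaApprox_apply, ← ContDiffBump.normed_neg]
    congr 1
    abel
  simp only [heven, mul_comm]

theorem tendsto_mollify {F : ℕ → Mink → ℂ} {x : Mink} {c : ℂ} (hF : ∀ k, Continuous (F k))
    (h : Tendsto (fun p : ℕ × Mink => F p.1 p.2) (atTop ×ˢ 𝓝 x) (𝓝 c)) :
    Tendsto (fun p : ℕ × Mink => mollify p.1 (F p.1) p.2) (atTop ×ˢ 𝓝 x) (𝓝 c) :=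
  ContDiffBump.convolution_tendsto_right (φ := fun p : ℕ × Mink => bump p.1)
    (g := fun p => F p.1) (tendsto_bump_rOut.comp tendsto_fst)
    (Eventually.of_forall fun p => (hF p.1).aestronglyMeasurable)
    (h.comp ((tendsto_fst.comp tendsto_fst).prodMk tendsto_snd)) tendsto_snd

theorem tendsto_integral_integral_deltaApprox {G : Mink → ℂ} (hG : Continuous G) (x y : Mink) :
    Tendsto (fun k => ∫ u, ((deltaApprox k u).1 x : ℂ) * mollify k G (u - y)) atTop
      (𝓝 (G (x - y))) := by
  have hinner : Tendsto (fun p : ℕ × Mink => mollify p.1 G (p.2 - y)) (atTop ×ˢ 𝓝 x)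
      (𝓝 (G (x - y))) := by
    have h := tendsto_mollify (F := fun _ => G) (x := x - y) (fun _ => hG)
      ((hG.tendsto _).comp tendsto_snd)
    exact h.comp (tendsto_fst.prodMk (tendsto_snd.sub_const y))
  have houter := tendsto_mollify (F := fun k u => mollify k G (u - y))
    (fun k => (continuous_mollify k hG).comp (continuous_id.sub continuous_const)) hinner
  exact (houter.comp (tendsto_id.prodMk tendsto_const_nhds)).congr fun k =>
    (integral_deltaApprox_mul k _ x).symm

end Mollification

section Contraction

/-- The functionals `D` and `E`, applied to the two arguments of the kernel `H (u - v)`, give the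
number `c`, the functionals being smeared with approximate delta functions. -/
structure HasContraction (H : Mink → ℂ) (D E : Conf → ℂ) (c : ℂ) : Prop where
  integrable : ∀ k u, Integrable fun v => D (deltaApprox k u) * H (u - v) * E (deltaApprox k v)
  integrable_integral : ∀ k, Integrable fun u =>
    ∫ v, D (deltaApprox k u) * H (u - v) * E (deltaApprox k v)
  tendsto : Tendsto (fun k => ∫ u, ∫ v, D (deltaApprox k u) * H (u - v) * E (deltaApprox k v))
    atTop (𝓝 c)

theorem IsXiTower.integral_mul_jet_deltaApprox {H : ℕ → Mink → ℂ} (hH : IsXiTower H) (m k : ℕ)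
    (u y : Mink) : ∫ v, H 0 (u - v) * (jet m y (deltaApprox k v) : ℂ) =
      (-1) ^ m * mollify k (H m) (u - y) := by
  have hsupp : HasCompactSupport fun x => (jet 0 x (deltaApprox k 0) : ℂ) :=
    (hasCompactSupport_deltaApprox k 0).comp_left Complex.ofReal_zero
  simp_rw [jet_deltaApprox m k y]
  rw [hH.integral_mul_comp_sub (isXiTower_jet (deltaApprox k 0)) hsupp, zero_add,
    ← integral_comp_sub_mul_deltaApprox]
  simp only [← jet_deltaApprox, jet_zero]

theorem IsXiTower.hasContraction {H : ℕ → Mink → ℂ} (hH : IsXiTower H) (m : ℕ) (x y : Mink) :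
    HasContraction (H 0) (fun h => (h.1 x : ℂ)) (fun h => (jet m y h : ℂ))
      ((-1) ^ m * H m (x - y)) := by
  have hinner (k : ℕ) (u : Mink) :
      ∫ v, ((deltaApprox k u).1 x : ℂ) * H 0 (u - v) * (jet m y (deltaApprox k v) : ℂ) =
        (-1) ^ m * (((deltaApprox k u).1 x : ℂ) * mollify k (H m) (u - y)) := by
    simp_rw [mul_assoc]
    rw [integral_const_mul, hH.integral_mul_jet_deltaApprox]
    ring
  have hsupp (k : ℕ) : HasCompactSupport fun v => ((deltaApprox k v).1 x : ℂ) := by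
    have h := ((bump k).hasCompactSupport_normed (μ := volume)).comp_homeomorph
      (Homeomorph.subLeft x)
    exact h.comp_left Complex.ofReal_zero
  have hcont (k : ℕ) : Continuous fun v => ((deltaApprox k v).1 x : ℂ) :=
    Complex.continuous_ofReal.comp
      (((bump k).contDiff_normed (n := 0)).continuous.comp (continuous_const.sub continuous_id))
  refine ⟨fun k u => ?_, fun k => ?_, ?_⟩
  · simp_rw [mul_assoc, jet_deltaApprox m k y]
    exact (hH.integrable_mul_comp_sub (isXiTower_jet (deltaApprox k 0))
      ((hasCompactSupport_deltaApprox k 0).comp_left Complex.ofReal_zero) 0 m u y).const_mul _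
  · simp_rw [hinner]
    exact (((hcont k).mul ((continuous_mollify k (hH.continuous m)).comp
      (continuous_id.sub continuous_const))).integrable_of_hasCompactSupport
        (hsupp k).mul_right).const_mul _
  · simp_rw [hinner, integral_const_mul]
    exact (tendsto_integral_integral_deltaApprox (hH.continuous m) x y).const_mul _

theorem hasContraction_feynman {μ : ℝ} (hμ : μ ≠ 0) {ε : ℝ} (hε : 0 < ε) (m : ℕ) (x y : Mink) :
    HasContraction (feynman μ ε) (fun h => (h.1 x : ℂ)) (fun h => (jet m y h : ℂ))
      ((-1) ^ m * propDeriv μ m ε (complexify (x - y))) := by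
  rw [funext (feynman_eq_propDeriv μ ε)]
  exact (isXiTower_propDeriv hμ hε).hasContraction m x y

variable {H : Mink → ℂ}

theorem HasContraction.const_mul {D E : Conf → ℂ} {c : ℂ} (h : HasContraction H D E c) (w z : ℂ) :
    HasContraction H (fun f => w * D f) (fun f => z * E f) (w * z * c) := by
  have hfactor (k : ℕ) (u v : Mink) :
      w * D (deltaApprox k u) * H (u - v) * (z * E (deltaApprox k v)) =
        w * z * (D (deltaApprox k u) * H (u - v) * E (deltaApprox k v)) := by ring
  constructor <;> simp_rw [hfactor]
  · exact fun k u => (h.integrable k u).const_mul _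
  · simp_rw [integral_const_mul]
    exact fun k => (h.integrable_integral k).const_mul _
  · simp_rw [integral_const_mul]
    exact h.tendsto.const_mul _

theorem HasContraction.sum {ι : Type*} (s : Finset ι) {D : ι → Conf → ℂ} {E : Conf → ℂ}
    {c : ι → ℂ} (h : ∀ i ∈ s, HasContraction H (D i) E (c i)) :
    HasContraction H (fun f => ∑ i ∈ s, D i f) E (∑ i ∈ s, c i) := by
  have hinner (k : ℕ) (u : Mink) :
      ∫ v, ∑ i ∈ s, D i (deltaApprox k u) * H (u - v) * E (deltaApprox k v) =
        ∑ i ∈ s, ∫ v, D i (deltaApprox k u) * H (u - v) * E (deltaApprox k v) :=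
    integral_finsetSum _ fun i hi => (h i hi).integrable k u
  constructor <;> simp_rw [Finset.sum_mul]
  · exact fun k u => integrable_finsetSum _ fun i hi => (h i hi).integrable k u
  · simp_rw [hinner]
    exact fun k => integrable_finsetSum _ fun i hi => (h i hi).integrable_integral k
  · simp_rw [hinner, fun k => integral_finsetSum s fun i hi => (h i hi).integrable_integral k]
    exact tendsto_finsetSum _ fun i hi => (h i hi).tendsto

theorem integral_sum_mul_prod {E ι : Type*} [MeasureSpace E] [SigmaFinite (volume : Measure E)]
    [Fintype ι] {n : ℕ} (w : ι → ℂ) {f : ι → Fin n → E → ℂ} (hf : ∀ s i, Integrable (f s i)) :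
    ∫ u : Fin n → E, ∑ s, w s * ∏ i, f s i (u i) = ∑ s, w s * ∏ i, ∫ u, f s i u := by
  have hint (s : ι) : Integrable fun u : Fin n → E => w s * ∏ i, f s i (u i) :=
    (Integrable.fintype_prod (hf s)).const_mul _
  rw [integral_finsetSum _ fun s _ => hint s]
  simp_rw [integral_const_mul, integral_fintype_prod_volume_eq_prod]

theorem pairing_eq_sum {ι κ : Type*} [Fintype ι] [Fintype κ] {n : ℕ}
    {A B : (Fin n → Conf) → ℂ} {a : ι → ℂ} {D : ι → Fin n → Conf → ℂ} {b : κ → ℂ}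
    {E : κ → Fin n → Conf → ℂ} {c : ι → κ → Fin n → ℂ}
    (hA : ∀ h, A h = ∑ s, a s * ∏ i, D s i (h i)) (hB : ∀ h, B h = ∑ t, b t * ∏ i, E t i (h i))
    (hc : ∀ s t i, HasContraction H (D s i) (E t i) (c s t i)) :
    pairing n H A B = ∑ s, ∑ t, a s * b t * ∏ i, c s t i := by
  let I (k : ℕ) (st : ι × κ) (i : Fin n) (u v : Mink) : ℂ :=
    D st.1 i (deltaApprox k u) * H (u - v) * E st.2 i (deltaApprox k v)
  have hexpand (k : ℕ) (u v : Fin n → Mink) :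
      A (fun i => deltaApprox k (u i)) * (∏ i, H (u i - v i)) * B (fun i => deltaApprox k (v i)) =
        ∑ st : ι × κ, a st.1 * b st.2 * ∏ i, I k st i (u i) (v i) := by
    rw [hA, hB, Finset.sum_mul, Finset.sum_mul_sum, ← Finset.sum_product',
      Finset.univ_product_univ]
    refine Finset.sum_congr rfl fun st _ => ?_
    simp only [I, Finset.prod_mul_distrib]
    ring
  have hinner (k : ℕ) (u : Fin n → Mink) :=
    integral_sum_mul_prod (fun st : ι × κ => a st.1 * b st.2)
      (f := fun st i v => I k st i (u i) v) fun st i => (hc st.1 st.2 i).integrable k (u i)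
  have houter (k : ℕ) :=
    integral_sum_mul_prod (fun st : ι × κ => a st.1 * b st.2)
      (f := fun st i u => ∫ v, I k st i u v) fun st i => (hc st.1 st.2 i).integrable_integral k
  rw [pairing, ← Fintype.sum_prod_type' (f := fun s t => a s * b t * ∏ i, c s t i)]
  simp_rw [hexpand, hinner, houter]
  exact (tendsto_finsetSum _ fun st _ =>
    (tendsto_finsetProd _ fun i _ => (hc st.1 st.2 i).tendsto).const_mul _).limUnder_eq

end Contraction

section Exponentials

theorem funcDeriv_zero (n : ℕ) (h : Fin n → Conf) : funcDeriv n h (0 : Obs) = 0 := by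
  induction n with
  | zero => rfl
  | succ n ih =>
    rw [funcDeriv, ih]
    funext φ
    simp [dirDeriv]

theorem funcDeriv_sum_exp {κ : Type*} [Fintype κ] (c : κ → ℂ) (ℓ : κ → Conf →ₗ[ℝ] ℂ) (n : ℕ)
    (h : Fin n → Conf) :
    funcDeriv n h (fun φ => ∑ s, c s * Complex.exp (ℓ s φ)) =
      fun φ => ∑ s, (c s * Complex.exp (ℓ s φ)) * ∏ i, ℓ s (h i) := by
  induction n with
  | zero => simp [funcDeriv]
  | succ n ih =>
    rw [funcDeriv, ih]
    funext φ
    have hline (s : κ) : HasDerivAt (fun t : ℝ => ℓ s (φ + t • h 0)) (ℓ s (h 0)) 0 := by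
      simpa using
        ((hasDerivAt_id (0 : ℝ)).ofReal_comp.mul_const (ℓ s (h 0))).const_add (ℓ s φ)
    refine (HasDerivAt.fun_sum fun s _ =>
      (((hline s).cexp.const_mul (c s)).mul_const _).congr_deriv ?_).deriv
    rw [zero_smul, add_zero, Fin.prod_univ_succ]
    ring

variable {H : Mink → ℂ}

theorem pairing_zero_right (n : ℕ) (A : (Fin n → Conf) → ℂ) :
    pairing n H A (fun _ => 0) = 0 := by
  simp only [pairing, mul_zero, integral_zero]
  exact tendsto_const_nhds.limUnder_eq

theorem coeff_star_C (F : PowerSeries Obs) (G : Obs) (p : ℕ) (φ : Conf) :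
    PowerSeries.coeff p (star H F (PowerSeries.C G)) φ =
      ∑ n ∈ Finset.range (p + 1), ((n.factorial : ℂ))⁻¹ * pairing n H
        (fun h => funcDeriv n h (PowerSeries.coeff (p - n) F) φ) (fun h => funcDeriv n h G φ) := by
  rw [star, PowerSeries.coeff_mk]
  refine Finset.sum_congr rfl fun n _ => ?_
  rw [Finset.sum_eq_single (p - n, 0)]
  · simp
  · rintro ⟨b, c⟩ hbc hne
    have hc : c ≠ 0 := by
      rintro rfl
      rw [Finset.HasAntidiagonal.mem_antidiagonal, add_zero] at hbc
      exact hne (by rw [← hbc])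
    simp [PowerSeries.coeff_C, hc, funcDeriv_zero, pairing_zero_right]
  · simp

theorem pairing_funcDeriv_sum_exp {κ ι : Type*} [Fintype κ] [Fintype ι] (c : κ → ℂ)
    (ℓ : κ → Conf →ₗ[ℝ] ℂ) {n : ℕ} {B : (Fin n → Conf) → ℂ} {b : ι → ℂ}
    {E : ι → Fin n → Conf → ℂ} (hB : ∀ h, B h = ∑ t, b t * ∏ i, E t i (h i))
    {g : κ → ι → Fin n → ℂ} (hg : ∀ s t i, HasContraction H (ℓ s) (E t i) (g s t i)) (φ : Conf) :
    pairing n H (fun h => funcDeriv n h (fun φ => ∑ s, c s * Complex.exp (ℓ s φ)) φ) B =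
      ∑ s, ∑ t, c s * Complex.exp (ℓ s φ) * b t * ∏ i, g s t i :=
  pairing_eq_sum (a := fun s => c s * Complex.exp (ℓ s φ)) (D := fun s _ => ℓ s)
    (fun h => by rw [funcDeriv_sum_exp]) hB hg

theorem add_pow_div_factorial (x y : ℂ) (p : ℕ) :
    (x + y) ^ p / (p.factorial : ℂ) = ∑ n ∈ Finset.range (p + 1),
      ((n.factorial : ℂ))⁻¹ * (x ^ (p - n) / ((p - n).factorial : ℂ)) * y ^ n := by
  rw [add_comm, add_pow, Finset.sum_div]
  refine Finset.sum_congr rfl fun n hn => ?_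
  have hfac (m : ℕ) : (m.factorial : ℂ) ≠ 0 := by exact_mod_cast m.factorial_ne_zero
  rw [Nat.cast_choose ℂ (Nat.lt_succ_iff.1 (Finset.mem_range.1 hn))]
  field_simp [hfac]

/-- The sum of the contractions `g i j` between all pairs `i < j` of factors, the `i`-th factor
being in the state `σ i`. -/
def contractionEnergy {κ : Type*} {l : ℕ} (g : Fin l → Fin l → κ → κ → ℂ) (σ : Fin l → κ) : ℂ :=
  ∑ j, ∑ i ∈ Finset.Iio j, g i j (σ i) (σ j)

theorem contractionEnergy_succ {κ : Type*} {l : ℕ} (g : Fin (l + 1) → Fin (l + 1) → κ → κ → ℂ)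
    (σ : Fin (l + 1) → κ) :
    contractionEnergy g σ =
      contractionEnergy (fun i j => g i.castSucc j.castSucc) (fun i => σ i.castSucc) +
        ∑ i : Fin l, g i.castSucc (Fin.last l) (σ i.castSucc) (σ (Fin.last l)) := by
  simp only [contractionEnergy, ← Finset.filter_gt_eq_Iio, Finset.sum_filter, Fin.sum_univ_castSucc,
    Fin.castSucc_lt_castSucc_iff, Fin.castSucc_lt_last, (Fin.castSucc_lt_last _).not_gt, lt_irrefl,
    if_true, if_false, add_zero]

theorem coeff_timeOrdered_sum_exp {κ : Type*} [Fintype κ] {l : ℕ} (c : Fin l → κ → ℂ)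
    (ℓ : Fin l → κ → Conf →ₗ[ℝ] ℂ) {g : Fin l → Fin l → κ → κ → ℂ}
    (hg : ∀ i j s t, HasContraction H (ℓ i s) (ℓ j t) (g i j s t)) (q : ℕ) :
    PowerSeries.coeff q (timeOrdered H l fun i =>
        PowerSeries.C fun φ => ∑ s, c i s * Complex.exp (ℓ i s φ)) =
      fun φ => ∑ σ : Fin l → κ, (∏ i, c i (σ i)) *
        (contractionEnergy g σ ^ q / (q.factorial : ℂ)) *
          Complex.exp ((∑ i, ℓ i (σ i) : Conf →ₗ[ℝ] ℂ) φ) := by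
  induction l generalizing q with
  | zero =>
    funext φ
    cases q <;> simp [timeOrdered, contractionEnergy, PowerSeries.coeff_one]
  | succ l ih =>
    funext φ
    have hcross (σ : Fin l → κ) (t : κ) :
        HasContraction H (∑ i, ℓ i.castSucc (σ i) : Conf →ₗ[ℝ] ℂ) (ℓ (Fin.last l) t)
          (∑ i, g i.castSucc (Fin.last l) (σ i) t) := by
      simpa only [← LinearMap.sum_apply] using
        HasContraction.sum Finset.univ fun i _ => hg (Fin.castSucc i) (Fin.last l) (σ i) t
    have hpair (n : ℕ) := pairing_funcDeriv_sum_exp (n := n)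
      (fun σ : Fin l → κ => (∏ i, c i.castSucc (σ i)) *
        (contractionEnergy (fun i j => g i.castSucc j.castSucc) σ ^ (q - n) /
          ((q - n).factorial : ℂ)))
      (fun σ => ∑ i, ℓ i.castSucc (σ i))
      (B := fun h => funcDeriv n h (fun φ => ∑ t, c (Fin.last l) t *
        Complex.exp (ℓ (Fin.last l) t φ)) φ)
      (fun h => by rw [funcDeriv_sum_exp]) (fun σ t _ => hcross σ t) φ
    simp_rw [timeOrdered, coeff_star_C, ih _ _ fun i j => hg i.castSucc j.castSucc, hpair,
      Finset.mul_sum]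
    rw [Finset.sum_comm, ← (Fin.snocEquiv fun _ : Fin (l + 1) => κ).sum_comp,
      Fintype.sum_prod_type_right]
    refine Finset.sum_congr rfl fun σ _ => ?_
    rw [Finset.sum_comm]
    refine Finset.sum_congr rfl fun t _ => ?_
    simp only [Fin.snocEquiv, Equiv.coe_fn_mk, contractionEnergy_succ, Fin.snoc_castSucc,
      Fin.snoc_last, Fin.prod_univ_castSucc, Fin.sum_univ_castSucc, LinearMap.add_apply,
      Complex.exp_add, add_pow_div_factorial, Finset.mul_sum, Finset.sum_mul,
      Finset.prod_const, Finset.card_univ, Fintype.card_fin]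
    refine Finset.sum_congr rfl fun n _ => ?_
    ring

end Exponentials

section Vertex

/-- The charge `± i a` of a vertex operator `e^{± i a φ(x)}`, the sign being encoded by a
boolean. -/
def charge (a : ℝ) (s : Bool) : ℂ := if s then Complex.I * a else -(Complex.I * a)

/-- The exponent `± i a φ(x)` of a vertex operator. -/
def vertexExp (a : ℝ) (s : Bool) (x : Mink) : Conf →ₗ[ℝ] ℂ :=
  charge a s • (Complex.ofRealCLM.toLinearMap ∘ₗ jet 0 x)

theorem vertexExp_apply (a : ℝ) (s : Bool) (x : Mink) (φ : Conf) :
    vertexExp a s x φ = charge a s * (φ.1 x : ℂ) := rfl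

theorem lInt_eq_sum_exp (a : ℝ) (x : Mink) :
    lInt a x = fun φ => ∑ s : Bool, (1 / 2 : ℂ) * Complex.exp (vertexExp a s x φ) := by
  funext φ
  simp only [lInt, Complex.ofReal_cos, Complex.cos, vertexExp_apply, charge, Fintype.sum_bool,
    if_true, Bool.false_eq_true, if_false, Complex.ofReal_mul]
  ring_nf

theorem funcDeriv_lInt (a : ℝ) (x : Mink) (n : ℕ) (h : Fin n → Conf) :
    funcDeriv n h (lInt a x) = fun φ => ∑ s : Bool,
      ((1 / 2 : ℂ) * ∏ i, vertexExp a s x (h i)) * Complex.exp (vertexExp a s x φ) := by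
  rw [lInt_eq_sum_exp, funcDeriv_sum_exp]
  simp_rw [mul_right_comm]

end Vertex

section Polynomials

open MvPolynomial

variable {σ τ R : Type*} [CommSemiring R]

theorem totalDegree_rename_of_injective {f : σ → τ} (hf : Function.Injective f)
    (P : MvPolynomial σ R) : (rename f P).totalDegree = P.totalDegree := by
  classical
  rw [totalDegree, support_rename_of_injective hf, Finset.sup_image]
  refine Finset.sup_congr rfl fun m _ => ?_
  exact Finsupp.sum_mapDomain_index (h := fun _ e => e) (fun _ => rfl) fun _ _ _ => rfl

theorem totalDegree_mkDerivation_le {f : σ → MvPolynomial σ R} {e : ℕ}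
    (hf : ∀ i, (f i).totalDegree ≤ e) (P : MvPolynomial σ R) :
    (mkDerivation R f P).totalDegree ≤ P.totalDegree - 1 + e := by
  conv_lhs => rw [P.as_sum, map_sum]
  refine totalDegree_finsetSum_le fun m hm => ?_
  rw [mkDerivation_monomial]
  refine (totalDegree_smul_le _ _).trans (totalDegree_finsetSum_le fun i hi => ?_)
  refine (totalDegree_mul _ _).trans (add_le_add ((totalDegree_monomial_le _ _).trans ?_) (hf i))
  have hmi : Finsupp.single i 1 ≤ m :=
    Finsupp.single_le_iff.2 (Nat.one_le_iff_ne_zero.2 (Finsupp.mem_support_iff.1 hi))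
  have hdeg : (m - Finsupp.single i 1).degree + 1 = m.degree := by
    conv_rhs => rw [← tsub_add_cancel_of_le hmi, map_add, Finsupp.degree_single]
  exact Nat.le_sub_of_add_le (hdeg.le.trans (le_totalDegree hm))

theorem totalDegree_pderiv_le (i : σ) (P : MvPolynomial σ R) :
    (pderiv i P).totalDegree ≤ P.totalDegree - 1 := by
  classical
  rw [pderiv_def]
  refine totalDegree_mkDerivation_le (e := 0) (fun j => ?_) P
  rcases eq_or_ne j i with rfl | hji
  · simp
  · simp [hji]

theorem pderiv_comm (i j : σ) (P : MvPolynomial σ R) :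
    pderiv i (pderiv j P) = pderiv j (pderiv i P) := by
  classical
  ext m
  simp only [coeff_pderiv]
  rcases eq_or_ne i j with rfl | h
  · rfl
  · simp only [add_right_comm m, Finsupp.add_apply, Finsupp.single_eq_of_ne h,
      Finsupp.single_eq_of_ne h.symm, add_zero]
    ring

/-- The iterated partial derivative of a polynomial in the variables listed in `L`. -/
def iterPderiv (L : List σ) (P : MvPolynomial σ R) : MvPolynomial σ R :=
  L.foldr (fun i Q => pderiv i Q) P

theorem iterPderiv_perm {L L' : List σ} (h : L.Perm L') (P : MvPolynomial σ R) :
    iterPderiv L P = iterPderiv L' P :=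
  h.foldr_eq' (fun i _ j _ Q => pderiv_comm j i Q) P

theorem totalDegree_iterPderiv_le (L : List σ) (P : MvPolynomial σ R) :
    (iterPderiv L P).totalDegree ≤ P.totalDegree - L.length := by
  induction L with
  | nil => rfl
  | cons i L ih =>
    exact (totalDegree_pderiv_le i _).trans ((Nat.sub_le_sub_right ih 1).trans (Nat.sub_sub ..).le)

theorem iterPderiv_eq_zero {L : List σ} {P : MvPolynomial σ R} (h : P.totalDegree < L.length) :
    iterPderiv L P = 0 := by
  cases L with
  | nil => simp at h
  | cons i L =>
    have hdeg : (iterPderiv L P).totalDegree = 0 :=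
      Nat.le_zero.1 ((totalDegree_iterPderiv_le L P).trans
        (Nat.sub_eq_zero_of_le (Nat.lt_succ_iff.1 h)).le)
    rw [iterPderiv, List.foldr_cons, ← iterPderiv, totalDegree_eq_zero_iff_eq_C.1 hdeg, pderiv_C]

theorem contDiff_eval {E : Type*} [NormedAddCommGroup E] [NormedSpace ℝ E] {n : WithTop ℕ∞}
    {u : σ → E → ℝ} (hu : ∀ i, ContDiff ℝ n (u i)) (P : MvPolynomial σ ℝ) :
    ContDiff ℝ n fun x => eval (fun i => u i x) P := by
  induction P using MvPolynomial.induction_on with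
  | C c => simpa using contDiff_const
  | add P Q hP hQ => simpa using hP.add hQ
  | mul_X P i hP => simpa using hP.mul (hu i)

theorem hasDerivAt_eval {u : σ → ℝ → ℝ} {t : ℝ}
    {D : Derivation ℝ (MvPolynomial σ ℝ) (MvPolynomial σ ℝ)}
    (hu : ∀ i, HasDerivAt (u i) (eval (fun i => u i t) (D (X i))) t) (P : MvPolynomial σ ℝ) :
    HasDerivAt (fun s => eval (fun i => u i s) P) (eval (fun i => u i t) (D P)) t := by
  induction P using MvPolynomial.induction_on with
  | C c => simpa [← algebraMap_eq] using hasDerivAt_const t c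
  | add P Q hP hQ => simpa using hP.fun_add hQ
  | mul_X P i hP =>
    simp only [map_mul, eval_X, Derivation.leibniz, smul_eq_mul, map_add]
    exact (hP.mul (hu i)).congr_deriv (by ring)

end Polynomials

section JetPolynomials

open MvPolynomial

/-- Local functionals of the configuration which at each point are given by one and the same
polynomial of degree at most `d` in the `ξ`-derivatives of the configuration. -/
def IsJetPoly (d : ℕ) (F : Conf → Mink → ℝ) : Prop :=
  ∃ P : MvPolynomial ℕ ℝ, P.totalDegree ≤ d ∧ ∀ φ x, F φ x = eval (fun m => jet m x φ) P

namespace IsJetPoly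

variable {d e : ℕ} {F G : Conf → Mink → ℝ}

theorem const (d : ℕ) (c : ℝ) : IsJetPoly d fun _ _ => c :=
  ⟨C c, by simp, by simp⟩

theorem zero (d : ℕ) : IsJetPoly d fun _ => 0 := const d 0

theorem apply : IsJetPoly 1 fun φ => φ.1 :=
  ⟨X 0, by simp, by simp [jet_zero]⟩

theorem mono (hF : IsJetPoly d F) (h : d ≤ e) : IsJetPoly e F :=
  hF.imp fun _ hP => ⟨hP.1.trans h, hP.2⟩

theorem add (hF : IsJetPoly d F) (hG : IsJetPoly d G) : IsJetPoly d fun φ => F φ + G φ := by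
  obtain ⟨P, hP, hPF⟩ := hF
  obtain ⟨Q, hQ, hQG⟩ := hG
  exact ⟨P + Q, (totalDegree_add P Q).trans (max_le hP hQ), by simp [hPF, hQG]⟩

theorem mul (hF : IsJetPoly d F) (hG : IsJetPoly e G) : IsJetPoly (d + e) fun φ => F φ * G φ := by
  obtain ⟨P, hP, hPF⟩ := hF
  obtain ⟨Q, hQ, hQG⟩ := hG
  exact ⟨P * Q, (totalDegree_mul P Q).trans (add_le_add hP hQ), by simp [hPF, hQG]⟩

theorem const_smul (hF : IsJetPoly d F) (c : ℝ) : IsJetPoly d fun φ => c • F φ := by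
  obtain ⟨P, hP, hPF⟩ := hF
  exact ⟨c • P, (totalDegree_smul_le c P).trans hP, by simp [hPF]⟩

theorem neg (hF : IsJetPoly d F) : IsJetPoly d fun φ => -F φ := by
  simpa using hF.const_smul (-1)

theorem sub (hF : IsJetPoly d F) (hG : IsJetPoly d G) : IsJetPoly d fun φ => F φ - G φ := by
  simpa [sub_eq_add_neg] using hF.add hG.neg

theorem sum {ι : Type*} {s : Finset ι} {F : ι → Conf → Mink → ℝ}
    (hF : ∀ i ∈ s, IsJetPoly d (F i)) : IsJetPoly d fun φ => ∑ i ∈ s, F i φ := by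
  classical
  induction s using Finset.induction_on with
  | empty => exact zero d
  | insert i s hi ih =>
    simp_rw [Finset.sum_insert hi]
    exact (hF i (Finset.mem_insert_self i s)).add
      (ih fun j hj => hF j (Finset.mem_insert_of_mem hj))

theorem dXi (hF : IsJetPoly d F) (hd : 1 ≤ d) : IsJetPoly d fun φ => dXi (F φ) := by
  obtain ⟨P, hP, hPF⟩ := hF
  refine ⟨mkDerivation ℝ (fun m => X (m + 1)) P, ?_, fun φ x => ?_⟩
  · have h := totalDegree_mkDerivation_le (R := ℝ) (f := fun m : ℕ => X (m + 1)) (e := 1)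
      (fun m => by simp) P
    omega
  · have hF : F φ = fun x => eval (fun m => jet m x φ) P := funext (hPF φ)
    simp only [hF]
    refine (hasDerivAt_eval (u := fun m s => jet m (x.1, s) φ) (fun m => ?_) P).deriv
    rw [mkDerivation_X, eval_X, congrFun (jet_succ m φ) x]
    exact hasDerivAt_dXi ((contDiff_jet m φ).differentiable (by simp)) x

theorem coeff_pow {B : Conf → PowerSeries (Mink → ℝ)}
    (hB : ∀ k, IsJetPoly k fun φ => PowerSeries.coeff k (B φ)) (d n : ℕ) :
    IsJetPoly n fun φ => PowerSeries.coeff n (B φ ^ d) := by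
  induction d generalizing n with
  | zero =>
    simp_rw [pow_zero, PowerSeries.coeff_one]
    split_ifs
    · exact const n 1
    · exact zero n
  | succ d ih =>
    simp_rw [pow_succ, PowerSeries.coeff_mul]
    refine sum fun p hp => ((ih p.1).mul (hB p.2)).mono ?_
    rw [Finset.HasAntidiagonal.mem_antidiagonal.1 hp]

end IsJetPoly

theorem coeff_subst_eq_sum_range {R : Type*} [CommRing R] (S : PowerSeries R) {B : PowerSeries R}
    (hB : PowerSeries.constantCoeff B = 0) (n : ℕ) :
    PowerSeries.coeff n (S.subst B) = ∑ d ∈ Finset.range (n + 1),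
      PowerSeries.coeff d S • PowerSeries.coeff n (B ^ d) := by
  rw [PowerSeries.coeff_subst' (PowerSeries.HasSubst.of_constantCoeff_zero' hB)]
  refine finsum_eq_sum_of_support_subset _ fun d hd => ?_
  rw [Finset.coe_range, Set.mem_Iio]
  by_contra hlt
  have hX : (PowerSeries.X : PowerSeries R) ^ d ∣ B ^ d :=
    pow_dvd_pow_of_dvd (PowerSeries.X_dvd_iff.2 hB) d
  have h0 : PowerSeries.coeff n (B ^ d) = 0 := PowerSeries.X_pow_dvd_iff.1 hX n (by omega)
  exact hd (by simp only [h0, smul_zero])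

theorem IsJetPoly.coeff_subst (S : PowerSeries ℝ) {B : Conf → PowerSeries (Mink → ℝ)}
    (hB0 : ∀ φ, PowerSeries.constantCoeff (B φ) = 0)
    (hB : ∀ k, IsJetPoly k fun φ => PowerSeries.coeff k (B φ)) (n : ℕ) :
    IsJetPoly n fun φ => PowerSeries.coeff n
      ((PowerSeries.map (algebraMap ℝ (Mink → ℝ)) S).subst (B φ)) := by
  simp_rw [coeff_subst_eq_sum_range _ (hB0 _), PowerSeries.coeff_map, algebraMap_smul]
  exact .sum fun d _ => (IsJetPoly.coeff_pow hB d n).const_smul _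

end JetPolynomials

section Backlund

variable {a : ℝ}

theorem backlundSeries_spec (ha : a ≠ 0) (φ : Mink → ℝ) :
    IsBacklundSeries a φ (backlundSeries a φ) := by
  have h := (existsUnique_backlundSeries ha φ).exists
  rw [backlundSeries, dif_pos h]
  exact h.choose_spec

theorem constantCoeff_backlundSeries_sub_C (ha : a ≠ 0) (φ : Mink → ℝ) :
    PowerSeries.constantCoeff (backlundSeries a φ - PowerSeries.C φ) = 0 := by
  rw [map_sub, ← PowerSeries.coeff_zero_eq_constantCoeff_apply, (backlundSeries_spec ha φ).1,
    PowerSeries.constantCoeff_C, sub_self]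

theorem coeff_succ_backlundSeries (ha : a ≠ 0) (φ : Mink → ℝ) (n : ℕ) :
    PowerSeries.coeff (n + 1) (backlundSeries a φ) =
      (2 / a : ℝ) • (dXi ((1 / 2 : ℝ) • (PowerSeries.coeff n (backlundSeries a φ) +
          if n = 0 then φ else 0)) -
        PowerSeries.coeff (n + 1) ((PowerSeries.sin (Mink → ℝ)).subst
          (backlundPart a (n + 1) fun k => PowerSeries.coeff k (backlundSeries a φ)))) := by
  have hmk : PowerSeries.mk (fun k => PowerSeries.coeff k (backlundSeries a φ)) =
      backlundSeries a φ := by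
    ext1 k
    rw [PowerSeries.coeff_mk]
  have hspec := backlundSeries_spec ha φ
  rw [← hmk] at hspec
  exact ((isBacklundSeries_iff ha φ _).1 hspec).2 n

theorem coeff_backlundPart_backlundSeries (ha : a ≠ 0) (φ : Mink → ℝ) (n k : ℕ) :
    PowerSeries.coeff k (backlundPart a n fun k => PowerSeries.coeff k (backlundSeries a φ)) =
      if k < n then (a / 2 : ℝ) • PowerSeries.coeff k (backlundSeries a φ - PowerSeries.C φ)
      else 0 := by
  rw [backlundPart, PowerSeries.coeff_mk, map_sub, PowerSeries.coeff_C]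
  rcases eq_or_ne k 0 with rfl | hk
  · simp [(backlundSeries_spec ha φ).1]
  · simp [hk]

theorem isJetPoly_coeff_backlundSeries_sub_C (ha : a ≠ 0) (n : ℕ) :
    IsJetPoly n fun φ => PowerSeries.coeff n (backlundSeries a φ.1 - PowerSeries.C φ.1) := by
  induction n using Nat.strong_induction_on with
  | _ n ih =>
    cases n with
    | zero =>
      simp_rw [PowerSeries.coeff_zero_eq_constantCoeff_apply,
        constantCoeff_backlundSeries_sub_C ha]
      exact .zero 0
    | succ n =>
      have hC : IsJetPoly (n + 1) fun φ => PowerSeries.coeff n (PowerSeries.C φ.1) := by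
        simp_rw [PowerSeries.coeff_C]
        split_ifs
        · exact IsJetPoly.apply.mono (Nat.le_add_left 1 n)
        · exact .zero _
      have hprev : IsJetPoly (n + 1) fun φ => PowerSeries.coeff n (backlundSeries a φ.1) := by
        simpa using ((ih n n.lt_succ_self).mono n.le_succ).add hC
      have hpart (k : ℕ) : IsJetPoly k fun φ => PowerSeries.coeff k
          (backlundPart a (n + 1) fun k => PowerSeries.coeff k (backlundSeries a φ.1)) := by
        simp_rw [coeff_backlundPart_backlundSeries ha]
        split_ifs with hk
        · exact (ih k hk).const_smul _
        · exact .zero k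
      have hpart0 (φ : Conf) : PowerSeries.constantCoeff
          (backlundPart a (n + 1) fun k => PowerSeries.coeff k (backlundSeries a φ.1)) = 0 := by
        rw [← PowerSeries.coeff_zero_eq_constantCoeff_apply, coeff_backlundPart_backlundSeries ha,
          if_pos n.succ_pos, PowerSeries.coeff_zero_eq_constantCoeff_apply,
          constantCoeff_backlundSeries_sub_C ha, smul_zero]
      have hsin := IsJetPoly.coeff_subst (PowerSeries.sin ℝ) hpart0 hpart (n + 1)
      rw [PowerSeries.map_sin] at hsin
      simp_rw [map_sub, PowerSeries.coeff_C, if_neg n.succ_ne_zero, sub_zero,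
        coeff_succ_backlundSeries ha, ← PowerSeries.coeff_C]
      exact ((((hprev.add hC).const_smul _).dXi n.succ_pos).sub hsin).const_smul _

theorem isJetPoly_coeff_currentSeries (ha : a ≠ 0) (n : ℕ) :
    IsJetPoly n fun φ => PowerSeries.coeff n (currentSeries a φ.1) := by
  have htwo : IsJetPoly n fun _ => PowerSeries.coeff n (2 : PowerSeries (Mink → ℝ)) := by
    simp_rw [← map_ofNat PowerSeries.C 2, PowerSeries.coeff_C]
    split_ifs
    · exact .const n 2
    · exact .zero n
  have hcos {B : Conf → PowerSeries (Mink → ℝ)}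
      (hB0 : ∀ φ, PowerSeries.constantCoeff (B φ) = 0)
      (hB : ∀ k, IsJetPoly k fun φ => PowerSeries.coeff k (B φ)) :
      IsJetPoly n fun φ =>
        PowerSeries.coeff n ((PowerSeries.cos (Mink → ℝ)).subst ((a / 2 : ℝ) • -B φ)) := by
    have h := IsJetPoly.coeff_subst (PowerSeries.cos ℝ) (B := fun φ => (a / 2 : ℝ) • -B φ)
      (fun φ => by simp [hB0]) (fun k => by simpa using ((hB k).neg.const_smul (a / 2))) n
    rwa [PowerSeries.map_cos] at h
  have hdiff := isJetPoly_coeff_backlundSeries_sub_C ha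
  have hdiff0 (φ : Conf) := constantCoeff_backlundSeries_sub_C ha φ.1
  have hrescale (k : ℕ) : IsJetPoly k fun φ => PowerSeries.coeff k
      (PowerSeries.rescale (-1 : Mink → ℝ) (backlundSeries a φ.1 - PowerSeries.C φ.1)) := by
    refine Eq.subst (motive := IsJetPoly k) (funext fun φ => ?_) ((hdiff k).const_smul ((-1) ^ k))
    rw [PowerSeries.coeff_rescale]
    ext x
    simp
  have hminus (φ : Mink → ℝ) :
      PowerSeries.C φ - PowerSeries.rescale (-1 : Mink → ℝ) (backlundSeries a φ) =
        -PowerSeries.rescale (-1 : Mink → ℝ) (backlundSeries a φ - PowerSeries.C φ) := by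
    rw [map_sub, neg_sub]
    congr 1
    ext1 k
    rw [PowerSeries.coeff_rescale, PowerSeries.coeff_C]
    split_ifs with hk <;> simp [hk]
  simp_rw [currentSeries, map_sub, hminus, ← neg_sub _ (PowerSeries.C _)]
  refine (htwo.sub (hcos (fun φ => ?_) hrescale)).sub (hcos hdiff0 hdiff)
  rw [← PowerSeries.coeff_zero_eq_constantCoeff_apply, PowerSeries.coeff_rescale, pow_zero, one_mul,
    PowerSeries.coeff_zero_eq_constantCoeff_apply, hdiff0]

end Backlund

section FunctionalDerivatives

open MvPolynomial

theorem hasDerivAt_eval_line {ι : Type*} [Fintype ι] (u w : ι → ℝ) (P : MvPolynomial ι ℝ) :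
    HasDerivAt (fun t : ℝ => eval (fun i => u i + t * w i) P)
      (∑ i, eval u (pderiv i P) * w i) 0 := by
  classical
  let D : Derivation ℝ (MvPolynomial ι ℝ) (MvPolynomial ι ℝ) := ∑ i, w i • pderiv i
  have hD (Q : MvPolynomial ι ℝ) : D Q = ∑ i, w i • pderiv i Q :=
    (congrFun (map_sum Derivation.coeFnAddMonoidHom (fun i => w i • pderiv (R := ℝ) i)
      Finset.univ) Q).trans (Finset.sum_apply _ _ _)
  refine (hasDerivAt_eval (u := fun i t => u i + t * w i) (D := D) (fun i => ?_) P).congr_deriv ?_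
  · have hline : HasDerivAt (fun t : ℝ => u i + t * w i) (w i) 0 := by
      simpa using ((hasDerivAt_id (0 : ℝ)).mul_const (w i)).const_add (u i)
    refine hline.congr_deriv ?_
    simp [hD, pderiv_X, Pi.single_apply]
  · simp [hD, mul_comm]

theorem funcDeriv_eval {ι : Type*} [Fintype ι] (ℓ : ι → Conf →ₗ[ℝ] ℝ) (P : MvPolynomial ι ℝ)
    (n : ℕ) (h : Fin n → Conf) :
    funcDeriv n h (fun φ => ((eval (fun i => ℓ i φ) P : ℝ) : ℂ)) = fun φ => ∑ κ : Fin n → ι,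
      ((eval (fun i => ℓ i φ) (iterPderiv (List.ofFn κ) P) : ℝ) : ℂ) *
        ∏ i, (ℓ (κ i) (h i) : ℂ) := by
  induction n with
  | zero => simp [funcDeriv, iterPderiv]
  | succ n ih =>
    rw [funcDeriv, ih]
    funext φ
    have hline (Q : MvPolynomial ι ℝ) :
        HasDerivAt (fun t : ℝ => ((eval (fun i => ℓ i (φ + t • h 0)) Q : ℝ) : ℂ))
          ((∑ i, eval (fun i => ℓ i φ) (pderiv i Q) * ℓ i (h 0) : ℝ) : ℂ) 0 := by
      simpa only [map_add, map_smul, smul_eq_mul] using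
        (hasDerivAt_eval_line (fun i => ℓ i φ) (fun i => ℓ i (h 0)) Q).ofReal_comp
    refine (HasDerivAt.fun_sum fun κ _ => (hline _).mul_const _).deriv.trans ?_
    rw [← (Fin.consEquiv fun _ : Fin (n + 1) => ι).sum_comp, Fintype.sum_prod_type_right]
    refine Finset.sum_congr rfl fun κ _ => ?_
    push_cast
    rw [Finset.sum_mul]
    refine Finset.sum_congr rfl fun m _ => ?_
    simp only [Fin.consEquiv, Equiv.coe_fn_mk, Fin.prod_univ_succ, Fin.cons_zero, Fin.cons_succ,
      List.ofFn_succ, iterPderiv, List.foldr_cons, mul_assoc]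

theorem IsJetPoly.exists_eval {d : ℕ} {F : Conf → Mink → ℝ} (hF : IsJetPoly d F) :
    ∃ (M : ℕ) (e : Fin M → ℕ) (P : MvPolynomial (Fin M) ℝ), P.totalDegree ≤ d ∧
      ∀ φ x, F φ x = eval (fun i => jet (e i) x φ) P := by
  obtain ⟨P, hP, hPF⟩ := hF
  obtain ⟨M, e, he, Q, rfl⟩ := exists_fin_rename P
  refine ⟨M, e, Q, (totalDegree_rename_of_injective he Q).symm.le.trans hP, fun φ x => ?_⟩
  rw [hPF, eval_rename]
  rfl

/-- The functional derivatives at `φ` of the local functionals `F x` are combinations of products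
of the jets of orders `e 0, …, e (M - 1)` at `x`, with the coefficients `β`; a list of indices says
which jets are multiplied. -/
def IsJetExpansion {M : ℕ} (F : Mink → Obs) (φ : Conf) (e : Fin M → ℕ)
    (β : List (Fin M) → Mink → ℝ) : Prop :=
  ∀ n (h : Fin n → Conf) x, funcDeriv n h (F x) φ =
    ∑ κ : Fin n → Fin M, (β (List.ofFn κ) x : ℂ) * ∏ i, (jet (e (κ i)) x (h i) : ℂ)

theorem exists_isJetExpansion_s2 {a : ℝ} (ha : a ≠ 0) (N : ℕ) (φ : Conf) :
    ∃ (M : ℕ) (e : Fin M → ℕ) (β : List (Fin M) → Mink → ℝ),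
      IsJetExpansion (s2 a N) φ e β ∧
      (∀ L L', L.Perm L' → β L = β L') ∧
      (∀ L, 2 * N + 2 < L.length → β L = 0) ∧
      ∀ L, ContDiff ℝ ∞ (β L) := by
  obtain ⟨M, e, P, hP, hPe⟩ := (isJetPoly_coeff_currentSeries ha (2 * N + 2)).exists_eval
  refine ⟨M, e, fun L x => eval (fun i => jet (e i) x φ) (iterPderiv L P),
    fun n h x => ?_, fun L L' h => ?_, fun L hL => ?_, fun L => ?_⟩
  · have hs2 : s2 a N x = fun φ => ((eval (fun i => jet (e i) x φ) P : ℝ) : ℂ) := by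
      funext φ
      rw [s2, hPe]
    rw [hs2, funcDeriv_eval]
  · simp_rw [iterPderiv_perm h]
  · simp_rw [iterPderiv_eq_zero (hP.trans_lt hL), map_zero]
    rfl
  · exact contDiff_eval (fun i => contDiff_jet (e i) φ) _

end FunctionalDerivatives

section FiberCardinalities

/-- The index of the block containing `k`, for consecutive blocks of lengths `J i`. -/
def blockIndex {l : ℕ} (J : Fin l → ℕ) (k : Fin (∑ i, J i)) : Fin l := (finSigmaFinEquiv.symm k).1

open MvPolynomial in
theorem coeff_prod_X {σ ι : Type*} [Fintype ι] [DecidableEq σ] (d : σ →₀ ℕ) (f : ι → σ)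
    [Decidable (∀ i, Finset.card {k | f k = i} = d i)] :
    coeff d (∏ k, (X (f k) : MvPolynomial σ ℕ)) =
      if ∀ i, Finset.card {k | f k = i} = d i then 1 else 0 := by
  have hprod : (∏ k, (X (f k) : MvPolynomial σ ℕ)) =
      monomial (∑ k, Finsupp.single (f k) 1) 1 := by
    simp only [X, monomial_sum_one]
  rw [hprod, coeff_monomial]
  congr 1
  simp only [Finsupp.ext_iff, Finsupp.finsetSum_apply, Finsupp.single_apply, Finset.sum_boole,
    Nat.cast_id]

open Finset in
theorem card_fiber_mul_prod_factorial {l n : ℕ} {J : Fin l → ℕ} (hJ : ∑ i, J i = n) :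
    #{f : Fin n → Fin l | ∀ i, #{k | f k = i} = J i} * ∏ i, (J i).factorial = n.factorial := by
  -- The coefficient of `∏ i, X i ^ J i` in `(∑ i, X i) ^ n` counts the maps with these fibers.
  have hcoeff :=
    MvPolynomial.coeff_sum_X_pow_of_fintype (R := ℕ) (Finsupp.equivFunOnFinite.symm J) n
  rw [if_pos ((Finsupp.sum_fintype _ _ fun _ => rfl).trans hJ),
    ← Finsupp.multinomial_of_support_subset (Finset.subset_univ _), Fintype.sum_pow,
    MvPolynomial.coeff_sum] at hcoeff
  simp_rw [coeff_prod_X, Finsupp.coe_equivFunOnFinite_symm, Nat.cast_id] at hcoeff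
  have hmultinomial := (Nat.multinomial_spec univ J).trans (congrArg Nat.factorial hJ)
  rw [mul_comm] at hmultinomial
  convert hmultinomial
  simpa only [Finset.card_filter] using hcoeff

open Finset in
theorem exists_equiv_blockIndex {l n : ℕ} {J : Fin l → ℕ} {f : Fin n → Fin l}
    (hf : ∀ i, #{k | f k = i} = J i) : ∃ e : Fin n ≃ Fin (∑ i, J i), blockIndex J ∘ e = f := by
  have hequiv (i : Fin l) : Nonempty ({k // f k = i} ≃ Fin (J i)) := by
    rw [← Fintype.card_eq, Fintype.card_fin, Fintype.card_subtype, hf]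
  let e := ((Equiv.sigmaFiberEquiv f).symm.trans
    (Equiv.sigmaCongrRight fun i => (hequiv i).some)).trans finSigmaFinEquiv
  exact ⟨e, funext fun k => by simp [e, blockIndex]⟩

theorem sum_pi_eq_sum_finAntidiagonal {l : ℕ} (W : ∀ n, (Fin n → Fin l) → ℂ)
    (hW : ∀ n n' (e : Fin n ≃ Fin n') f, W n (f ∘ e) = W n' f) (n : ℕ) :
    (n.factorial : ℂ)⁻¹ * ∑ f, W n f = ∑ J ∈ Finset.finAntidiagonal l n,
      (∏ i, ((J i).factorial : ℂ))⁻¹ * W (∑ i, J i) (blockIndex J) := by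
  classical
  let fiberCard (f : Fin n → Fin l) (i : Fin l) : ℕ := Finset.card {k | f k = i}
  have hmaps (f) (_ : f ∈ Finset.univ) : fiberCard f ∈ Finset.finAntidiagonal l n := by
    rw [Finset.mem_finAntidiagonal,
      ← Finset.card_eq_sum_card_fiberwise fun _ _ => Finset.mem_univ _, Finset.card_fin]
  rw [← Finset.sum_fiberwise_of_maps_to hmaps, Finset.mul_sum]
  refine Finset.sum_congr rfl fun J hJ => ?_
  have hconst (f) (hf : f ∈ Finset.univ.filter (fiberCard · = J)) :
      W n f = W (∑ i, J i) (blockIndex J) := by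
    obtain ⟨e, rfl⟩ := exists_equiv_blockIndex (congrFun (Finset.mem_filter.1 hf).2)
    exact hW _ _ e _
  have hcard : Finset.card {f | fiberCard f = J} * ∏ i, (J i).factorial = n.factorial := by
    simpa only [funext_iff] using
      card_fiber_mul_prod_factorial (Finset.mem_finAntidiagonal.1 hJ)
  have hn : (n.factorial : ℂ) ≠ 0 := Nat.cast_ne_zero.2 n.factorial_ne_zero
  have hprod : ∏ i, ((J i).factorial : ℂ) ≠ 0 :=
    Finset.prod_ne_zero_iff.2 fun i _ => Nat.cast_ne_zero.2 (J i).factorial_ne_zero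
  rw [Finset.sum_congr rfl hconst, Finset.sum_const, nsmul_eq_mul, ← mul_assoc]
  congr 1
  rw [inv_mul_eq_iff_eq_mul₀ hn, ← div_eq_mul_inv, eq_div_iff hprod]
  exact_mod_cast hcard

end FiberCardinalities

section Expansion

variable {a μ ε : ℝ} {l N M n : ℕ}

/-- The vertex operators `exp (± i a φ(x i))`, with the signs `σ`, contribute this coefficient of
`ħ ^ q` to the time-ordered product of the interaction Lagrangians. -/
def vertexWeight (a : ℝ) (H : Mink → ℂ) (φ : Conf) (q : ℕ) (σ : Fin l → Bool) (x : Fin l → Mink) :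
    ℂ :=
  (∏ _i : Fin l, (1 / 2 : ℂ)) *
    (contractionEnergy (fun i j s t => charge a s * charge a t * H (x i - x j)) σ ^ q /
      (q.factorial : ℂ)) *
    Complex.exp ((∑ i, vertexExp a (σ i) (x i) : Conf →ₗ[ℝ] ℂ) φ)

/-- The contraction, by the regularised Feynman propagator, of a vertex operator at `x` with the
`m`-th `ξ`-derivative of the field at `y`. -/
def vertexContraction (a μ ε : ℝ) (s : Bool) (m : ℕ) (x y : Mink) : ℂ :=
  charge a s * ((-1) ^ m * propDeriv μ m ε (complexify (x - y)))

theorem hasContraction_vertexExp_jet (hμ : μ ≠ 0) (hε : 0 < ε) (s : Bool) (m : ℕ) (x y : Mink) :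
    HasContraction (feynman μ ε) (vertexExp a s x) (fun h => (jet m y h : ℂ))
      (vertexContraction a μ ε s m x y) := by
  have h := (hasContraction_feynman hμ hε m x y).const_mul (charge a s) 1
  simp only [one_mul, mul_one] at h
  exact h

theorem hasContraction_vertexExp (hμ : μ ≠ 0) (hε : 0 < ε) (s t : Bool) (x y : Mink) :
    HasContraction (feynman μ ε) (vertexExp a s x) (vertexExp a t y)
      (charge a s * charge a t * feynman μ ε (x - y)) := by
  have h := (hasContraction_feynman hμ hε 0 x y).const_mul (charge a s) (charge a t)
  rw [← feynman_eq_propDeriv, pow_zero, one_mul] at h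
  exact h

theorem coeff_timeOrdered_funcDeriv_lInt (hμ : μ ≠ 0) (hε : 0 < ε) (φ : Conf) (J : Fin l → ℕ)
    (q : ℕ) (x : Fin l → Mink) (h : Fin (∑ i, J i) → Conf) :
    PowerSeries.coeff q (timeOrdered (feynman μ ε) l fun i => PowerSeries.C
        (funcDeriv (J i) (fun k => h (finSigmaFinEquiv ⟨i, k⟩)) (lInt a (x i)))) φ =
      ∑ σ : Fin l → Bool, vertexWeight a (feynman μ ε) φ q σ x *
        ∏ k, vertexExp a (σ (blockIndex J k)) (x (blockIndex J k)) (h k) := by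
  simp_rw [funcDeriv_lInt]
  rw [coeff_timeOrdered_sum_exp _ _ fun i j s t => hasContraction_vertexExp hμ hε s t (x i) (x j)]
  refine Finset.sum_congr rfl fun σ _ => ?_
  rw [← finSigmaFinEquiv.prod_comp, Fintype.prod_sigma, Finset.prod_mul_distrib, vertexWeight]
  simp only [blockIndex, Equiv.symm_apply_apply]
  ring

/-- The contraction of a functional with the jet coefficients `β` at the last point with `n` vertex
operators, the `k`-th of its functional derivatives being joined to the vertex operator `f k`. -/
def jetContraction (a μ ε : ℝ) (e : Fin M → ℕ) (β : List (Fin M) → Mink → ℝ)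
    (x : Fin (l + 1) → Mink) (σ : Fin l → Bool) (n : ℕ) (f : Fin n → Fin l) : ℂ :=
  ∑ κ : Fin n → Fin M, (β (List.ofFn κ) (x (Fin.last l)) : ℂ) *
    ∏ k, vertexContraction a μ ε (σ (f k)) (e (κ k)) (x (f k).castSucc) (x (Fin.last l))

variable {φ : Conf} {e : Fin M → ℕ} {β : List (Fin M) → Mink → ℝ}

theorem jetContraction_comp_equiv (hβ : ∀ L L', L.Perm L' → β L = β L') (x : Fin (l + 1) → Mink)
    (σ : Fin l → Bool) {n n' : ℕ} (g : Fin n ≃ Fin n') (f : Fin n' → Fin l) :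
    jetContraction a μ ε e β x σ n (f ∘ g) = jetContraction a μ ε e β x σ n' f := by
  obtain rfl : n = n' := Fin.equiv_iff_eq.1 ⟨g⟩
  refine Fintype.sum_equiv (Equiv.arrowCongr g (Equiv.refl _)) _ _ fun κ => ?_
  congr 1
  · rw [hβ _ _ (Equiv.Perm.ofFn_comp_perm g.symm κ).symm]
    rfl
  · exact Fintype.prod_equiv g _ _ fun k => by simp [Equiv.arrowCongr]

theorem jetContraction_eq_zero {d : ℕ} (hβ : ∀ L, d < L.length → β L = 0) (hn : d < n)
    (x : Fin (l + 1) → Mink) (σ : Fin l → Bool) (f : Fin n → Fin l) :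
    jetContraction a μ ε e β x σ n f = 0 :=
  Finset.sum_eq_zero fun κ _ => by simp [hβ (List.ofFn κ) (by rwa [List.length_ofFn])]

theorem sum_jetContraction (x : Fin (l + 1) → Mink) (σ : Fin l → Bool) (n : ℕ) :
    ∑ f, jetContraction a μ ε e β x σ n f =
      ∑ κ : Fin n → Fin M, (β (List.ofFn κ) (x (Fin.last l)) : ℂ) *
        ∏ k, ∑ i, vertexContraction a μ ε (σ i) (e (κ k)) (x i.castSucc) (x (Fin.last l)) := by
  simp only [jetContraction]
  rw [Finset.sum_comm]
  refine Finset.sum_congr rfl fun κ _ => ?_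
  rw [Finset.prod_univ_sum, Fintype.piFinset_univ, Finset.mul_sum]

theorem termKernel_eq (hμ : μ ≠ 0) (hβ : IsJetExpansion (s2 a N) φ e β) (hε : 0 < ε)
    (J : Fin l → ℕ) (q : ℕ) (x : Fin (l + 1) → Mink) :
    termKernel a μ l N φ J q ε x = ∑ σ : Fin l → Bool,
      vertexWeight a (feynman μ ε) φ q σ (fun i => x i.castSucc) *
        jetContraction a μ ε e β x σ (∑ i, J i) (blockIndex J) := by
  simp only [jetContraction, Finset.mul_sum, ← mul_assoc]
  rw [termKernel]
  exact pairing_eq_sum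
    (D := fun (σ : Fin l → Bool) k =>
      vertexExp a (σ (blockIndex J k)) (x (blockIndex J k).castSucc))
    (E := fun (κ : Fin (∑ i, J i) → Fin M) k h => (jet (e (κ k)) (x (Fin.last l)) h : ℂ))
    (coeff_timeOrdered_funcDeriv_lInt hμ hε φ J q fun i => x i.castSucc)
    (fun h => hβ (∑ i, J i) h (x (Fin.last l)))
    fun σ κ k => hasContraction_vertexExp_jet hμ hε _ (e (κ k)) _ _

theorem pairing_timeOrdered_lInt (hμ : μ ≠ 0) (hβ : IsJetExpansion (s2 a N) φ e β) (hε : 0 < ε)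
    (n q : ℕ) (x : Fin (l + 1) → Mink) :
    pairing n (feynman μ ε) (fun h => funcDeriv n h (PowerSeries.coeff q
          (timeOrdered (feynman μ ε) l fun i => PowerSeries.C (lInt a (x i.castSucc)))) φ)
        (fun h => funcDeriv n h (s2 a N (x (Fin.last l))) φ) =
      ∑ σ : Fin l → Bool, vertexWeight a (feynman μ ε) φ q σ (fun i => x i.castSucc) *
        ∑ f, jetContraction a μ ε e β x σ n f := by
  have hsum (σ : Fin l → Bool) (m : ℕ) : HasContraction (feynman μ ε)
      (∑ i, vertexExp a (σ i) (x i.castSucc) : Conf →ₗ[ℝ] ℂ)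
      (fun h => (jet m (x (Fin.last l)) h : ℂ))
      (∑ i, vertexContraction a μ ε (σ i) m (x i.castSucc) (x (Fin.last l))) := by
    simpa only [← LinearMap.sum_apply] using HasContraction.sum Finset.univ fun i _ =>
      hasContraction_vertexExp_jet hμ hε (σ i) m (x (Fin.castSucc i)) (x (Fin.last l))
  simp_rw [lInt_eq_sum_exp]
  rw [coeff_timeOrdered_sum_exp _ _ fun i j s t =>
      hasContraction_vertexExp hμ hε s t (x (Fin.castSucc i)) (x (Fin.castSucc j)),
    pairing_funcDeriv_sum_exp _ _
      (E := fun (κ : Fin n → Fin M) k h => (jet (e (κ k)) (x (Fin.last l)) h : ℂ))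
      (fun h => hβ n h (x (Fin.last l)))
      fun σ κ k => hsum σ (e (κ k))]
  simp_rw [sum_jetContraction, Finset.mul_sum, ← mul_assoc]
  rfl

theorem inv_factorial_mul_pairing (ha : a ≠ 0) (hμ : μ ≠ 0) (hε : 0 < ε) (φ : Conf) (n q : ℕ)
    (x : Fin (l + 1) → Mink) :
    (n.factorial : ℂ)⁻¹ * pairing n (feynman μ ε) (fun h => funcDeriv n h (PowerSeries.coeff q
          (timeOrdered (feynman μ ε) l fun i => PowerSeries.C (lInt a (x i.castSucc)))) φ)
        (fun h => funcDeriv n h (s2 a N (x (Fin.last l))) φ) =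
      ∑ J ∈ Finset.finAntidiagonal l n,
        (((∏ i, ((J i).factorial : ℝ))⁻¹ : ℝ) : ℂ) * termKernel a μ l N φ J q ε x := by
  obtain ⟨M, e, β, hβ, hperm, -, -⟩ := exists_isJetExpansion_s2 ha N φ
  rw [pairing_timeOrdered_lInt hμ hβ hε, Finset.mul_sum]
  simp_rw [mul_left_comm (n.factorial : ℂ)⁻¹, sum_pi_eq_sum_finAntidiagonal
    (jetContraction a μ ε e β x _) (fun _ _ => jetContraction_comp_equiv hperm x _) n,
    termKernel_eq hμ hβ hε, Finset.mul_sum]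
  rw [Finset.sum_comm]
  push_cast
  simp_rw [mul_left_comm]

theorem termKernel_eq_zero (ha : a ≠ 0) (hμ : μ ≠ 0) (hε : 0 < ε) (φ : Conf) {J : Fin l → ℕ}
    (hJ : 2 * N + 2 < ∑ i, J i) (q : ℕ) (x : Fin (l + 1) → Mink) :
    termKernel a μ l N φ J q ε x = 0 := by
  obtain ⟨M, e, β, hβ, -, hzero, -⟩ := exists_isJetExpansion_s2 ha N φ
  rw [termKernel_eq hμ hβ hε]
  exact Finset.sum_eq_zero fun σ _ => by rw [jetContraction_eq_zero hzero hJ, mul_zero]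

theorem lhsKernel_eq (ha : a ≠ 0) (hμ : μ ≠ 0) (hε : 0 < ε) (φ : Conf) (p : ℕ)
    (x : Fin (l + 1) → Mink) :
    lhsKernel a μ l N φ p ε x = ∑ j ∈ Finset.range (2 * (N + 1) + 1),
      if j ≤ p then ∑ J ∈ Finset.finAntidiagonal l j,
        (((∏ i, ((J i).factorial : ℝ))⁻¹ : ℝ) : ℂ) * termKernel a μ l N φ J (p - j) ε x else 0 := by
  rw [lhsKernel, timeOrdered]
  simp only [Fin.snoc_castSucc, Fin.snoc_last]
  rw [coeff_star_C]
  simp_rw [inv_factorial_mul_pairing ha hμ hε]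
  rw [← Finset.sum_filter]
  refine (Finset.sum_subset (fun j hj => ?_) fun j hjp hj => Finset.sum_eq_zero fun J hJ => ?_).symm
  · exact Finset.mem_range_succ_iff.2 (Finset.mem_filter.1 hj).2
  · have hdeg : 2 * N + 2 < ∑ i, J i := by
      simp only [Finset.mem_filter, Finset.mem_range, not_and] at hj hjp
      rw [Finset.mem_finAntidiagonal.1 hJ]
      omega
    rw [termKernel_eq_zero ha hμ hε φ hdeg, mul_zero]

end Expansion

section ExistenceOfBoundaryValues

variable {a μ : ℝ} {l : ℕ}

theorem propDeriv_complexify_sub {n : ℕ} (μ : ℝ) (m : ℕ) (ε : ℝ) (x : Fin n → Mink) (i j : Fin n) :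
    propDeriv μ m ε (complexify (x i - x j)) =
      propDeriv μ m ε (wickTuple 0 x i - wickTuple 0 x j) := by
  rw [wickTuple_apply, wickTuple_apply, ← map_sub, wickCLM_zero]

theorem contDiff_exp_sum_vertexExp (a : ℝ) (φ : Conf) (σ : Fin l → Bool) :
    ContDiff ℝ ∞ fun x : Fin (l + 1) → Mink =>
      Complex.exp ((∑ i, vertexExp a (σ i) (x i.castSucc) : Conf →ₗ[ℝ] ℂ) φ) := by
  simp only [LinearMap.sum_apply, vertexExp_apply]
  exact (ContDiff.sum fun i _ => contDiff_const.mul (Complex.ofRealCLM.contDiff.comp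
    (φ.contDiff.comp (contDiff_apply ℝ Mink (Fin.castSucc i))))).cexp

theorem exists_isContinuousBoundaryValue_vertexWeight_mul (hμ : μ ≠ 0) (φ : Conf) (q : ℕ)
    (σ : Fin l → Bool) {n : ℕ} (f : Fin n → Fin l) (m : Fin n → ℕ) {b : Mink → ℝ}
    (hb : ContDiff ℝ ∞ b) :
    ∃ u, IsContinuousBoundaryValue (fun ε (x : Fin (l + 1) → Mink) =>
      vertexWeight a (feynman μ ε) φ q σ (fun i => x i.castSucc) *
        ((b (x (Fin.last l)) : ℂ) * ∏ k, vertexContraction a μ ε (σ (f k)) (m k)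
          (x (f k).castSucc) (x (Fin.last l)))) u := by
  have henergy : IsWickRotatable fun ε (z : Fin (l + 1) → ℂ × ℂ) =>
      contractionEnergy (fun i j s t => charge a s * charge a t *
        propDeriv μ 0 ε (z i.castSucc - z j.castSucc)) σ :=
    .sum _ fun j _ => .sum _ fun i hij => (IsWickRotatable.const _).mul
      (isWickRotatable_propDeriv hμ 0 ((Fin.castSucc_injective l).ne (Finset.mem_Iio.1 hij).ne))
  have hprod : IsWickRotatable fun ε (z : Fin (l + 1) → ℂ × ℂ) =>
      ∏ k, charge a (σ (f k)) * ((-1) ^ m k *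
        propDeriv μ (m k) ε (z (f k).castSucc - z (Fin.last l))) :=
    .prod _ fun k _ => (IsWickRotatable.const _).mul ((IsWickRotatable.const _).mul
      (isWickRotatable_propDeriv hμ (m k) (Fin.castSucc_lt_last _).ne))
  have hsmooth : ContDiff ℝ ∞ fun x : Fin (l + 1) → Mink => (∏ _i : Fin l, (1 / 2 : ℂ)) /
      (q.factorial : ℂ) * (Complex.exp ((∑ i, vertexExp a (σ i) (x i.castSucc) : Conf →ₗ[ℝ] ℂ) φ) *
        (b (x (Fin.last l)) : ℂ)) :=
    contDiff_const.mul ((contDiff_exp_sum_vertexExp a φ σ).mul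
      (Complex.ofRealCLM.contDiff.comp (hb.comp (contDiff_apply ℝ Mink (Fin.last l)))))
  obtain ⟨u, hu⟩ := ((henergy.pow q).mul hprod).exists_isContinuousBoundaryValue hsmooth
  refine ⟨u, hu.congr fun ε _ => funext fun x => ?_⟩
  simp only [vertexWeight, vertexContraction, feynman_eq_propDeriv, propDeriv_complexify_sub]
  ring

theorem isContinuousBoundaryValue_unrenormTerm (ha : a ≠ 0) (hμ : μ ≠ 0) (N : ℕ) (φ : Conf)
    (J : Fin l → ℕ) (q : ℕ) :
    IsContinuousBoundaryValue (termKernel a μ l N φ J q) (unrenormTerm a μ l N φ J q) := by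
  obtain ⟨M, e, β, hβ, -, -, hsmooth⟩ := exists_isJetExpansion_s2 ha N φ
  choose u hu using fun (σ : Fin l → Bool) (κ : Fin (∑ i, J i) → Fin M) =>
    exists_isContinuousBoundaryValue_vertexWeight_mul (a := a) hμ φ q σ (blockIndex J)
      (fun k => e (κ k)) (hsmooth (List.ofFn κ))
  have h := (IsContinuousBoundaryValue.sum Finset.univ fun σ _ =>
    IsContinuousBoundaryValue.sum Finset.univ fun κ _ => hu σ κ).congr
      (κ' := termKernel a μ l N φ J q) fun ε hε => funext fun x => by
        simp only [termKernel_eq hμ hβ hε, jetContraction, Finset.mul_sum]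
  rwa [unrenormTerm, h.2.boundaryValue_eq]

theorem isContinuousBoundaryValue_lhsKernel (ha : a ≠ 0) (hμ : μ ≠ 0) (N : ℕ) (φ : Conf) (p : ℕ) :
    IsContinuousBoundaryValue (lhsKernel a μ l N φ p)
      ((∑ j ∈ Finset.range (2 * (N + 1) + 1), hbarPow j
        (∑ J ∈ Finset.finAntidiagonal l j,
          (∏ i, ((J i).factorial : ℝ))⁻¹ • unrenormTerm a μ l N φ J)) p) := by
  rw [Finset.sum_apply]
  refine (IsContinuousBoundaryValue.sum _ fun j _ => ?_).congr fun ε hε =>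
    funext (lhsKernel_eq ha hμ hε φ p)
  unfold hbarPow
  split_ifs with hj
  · rw [Finset.sum_apply]
    exact .sum _ fun J _ => (isContinuousBoundaryValue_unrenormTerm ha hμ N φ J (p - j)).smul _
  · exact .zero

end ExistenceOfBoundaryValues

end

end SineGordon

theorem mainTheorem10 (a μ : ℝ) (ha : 0 < a) (hμ : 0 < μ) (l N : ℕ) (φ : SineGordon.Conf) :
    (∀ p, ∃ u, SineGordon.IsBoundaryValue (SineGordon.lhsKernel a μ l N φ p) u) ∧
    (∀ (J : Fin l → ℕ) (q : ℕ), ∃ u,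
      SineGordon.IsBoundaryValue (SineGordon.termKernel a μ l N φ J q) u) ∧
    SineGordon.unrenormT a μ l N φ =
      ∑ j ∈ Finset.range (2 * (N + 1) + 1), SineGordon.hbarPow j
        (∑ J ∈ Finset.finAntidiagonal l j,
          (∏ i, ((J i).factorial : ℝ))⁻¹ • SineGordon.unrenormTerm a μ l N φ J) :=
  ⟨fun p => ⟨_, (SineGordon.isContinuousBoundaryValue_lhsKernel ha.ne' hμ.ne' N φ p).2⟩,
    fun J q => ⟨_, (SineGordon.isContinuousBoundaryValue_unrenormTerm ha.ne' hμ.ne' N φ J q).2⟩,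
    funext fun p =>
      (SineGordon.isContinuousBoundaryValue_lhsKernel ha.ne' hμ.ne' N φ p).2.boundaryValue_eq⟩
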